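/- \textbf{Theorem (bankruptcy in Erdős–Rényi credit networks).} \emph{Model.} Let $G$ be a simple graph on $n$ nodes and $c\ge 1$ an integer. A \emph{state} assigns to each ordered pair $(u,v)$ of adjacent nodes an integer $c_{uv}\ge 0$, the credit that $u$ extends to $v$, with $c_{uv}+c_{vu}=c$ for every edge. A unit payment from $s$ to $t$ can be routed along a path from $s$ to $t$ in $G$ if $c_{yx}\ge 1$ for every step $(x,y)$ of the path; routing it replaces $c_{xy}$ by $c_{xy}+1$ and $c_{yx}$ by $c_{yx}-1$ for every such step. Let $\Lambda=(\lambda_{st})$ be a nonnegative matrix indexed by the nodes with $\lambda_{ss}=0$ and $\sum_{s,t}\lambda_{st}=1$. The Markov chain $\mathcal M(G,\Lambda)$ on the set of states picks at each time step a pair $(s,t)$ with probability $\lambda_{st}$ and routes a unit payment from $s$ to $t$ along a shortest feasible path (ties being settled by any fixed rule that picks a path for each state and each pair $(s,t)$); if there is no feasible path, the state does not change. The chain is \emph{ergodic} if it is irreducible and aperiodic. Node $v$ is \emph{bankrupt} in a state if $c_{uv}=0$ for all neighbours $u$ of $v$ (in particular an isolated node is bankrupt). \emph{Random graph.} $G_c(n,p)$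 is the random graph on $n$ nodes in which every edge is present independently with probability $p$, each present edge having total credit capacity $c$. \emph{Claim.} There are absolute constants $k,K>0$ such that the following holds for all integers $n\ge1$ and $c\ge1$ and all $p\in[0,1]$ with $p>8\ln(cn)/n$. Suppose that for almost every $G$ drawn from $G_c(n,p)$ a symmetric transaction rate matrix $\Lambda=\Lambda_G$ (and a tie-breaking rule) is given for which $\mathcal M(G,\Lambda_G)$ is ergodic. Then, for almost every $G$, this chain has a unique stationary distribution $\pi_G$, and for every fixed node $v$ $$\frac{k}{npc}\;\le\;\mathbb E_{G\sim G_c(n,p)}\bigl[\pi_G(v\text{ is bankrupt})\bigr]\;\le\;\frac{K}{npc}.$$ That is, the steady-state probability that $v$ goes bankrupt is $\Theta(1/(npc))$ in expectation over the random graph. -/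

import Mathlib

/-- A state of the credit network on the graph `G` in which every edge has total credit capacity
`c`: `cap u v` is the number of units of credit that `u` currently extends to `v` (the capacity
`c_{uv}`), with `c_{uv} + c_{vu} = c` on edges and no credit off the edges. -/
@[ext]
structure CreditState {V : Type*} (G : SimpleGraph V) (c : ℕ) where
  cap : V → V → ℕ
  cap_add_cap : ∀ u v, G.Adj u v → cap u v + cap v u = c
  cap_eq_zero : ∀ u v, ¬ G.Adj u v → cap u v = 0

namespace CreditState

variable {V : Type*} {G : SimpleGraph V} {c : ℕ}

theorem cap_le (S : CreditState G c) (u v : V) : S.cap u v ≤ c := by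
  by_cases h : G.Adj u v
  · have := S.cap_add_cap u v h
    omega
  · simp [S.cap_eq_zero u v h]

instance [Finite V] : Finite (CreditState G c) := by
  refine Finite.of_injective
    (fun (S : CreditState G c) (u v : V) =>
      (⟨S.cap u v, Nat.lt_succ_of_le (S.cap_le u v)⟩ : Fin (c + 1))) ?_
  intro S T h
  ext u v
  simpa using congrFun (congrFun h u) v

noncomputable instance [Finite V] : Fintype (CreditState G c) := Fintype.ofFinite _

/-- `w` is a path along which the payer `s` can route a unit payment to the payee `t`. A payment
from `x` to a neighbour `y` uses up one unit of the credit that `y` extends to `x`. -/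
def IsFeasiblePath (S : CreditState G c) {s t : V} (w : G.Walk s t) : Prop :=
  w.IsPath ∧ ∀ d ∈ w.darts, 0 < S.cap d.snd d.fst

/-- `w` is a feasible path from `s` to `t` of minimal length. -/
def IsShortestFeasiblePath (S : CreditState G c) {s t : V} (w : G.Walk s t) : Prop :=
  S.IsFeasiblePath w ∧ ∀ w' : G.Walk s t, S.IsFeasiblePath w' → w.length ≤ w'.length

/-- A unit payment from `s` to `t` can be routed. -/
def CanPay (S : CreditState G c) (s t : V) : Prop :=
  ∃ w : G.Walk s t, S.IsFeasiblePath w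

theorem not_mem_darts_reverse {s t : V} {w : G.Walk s t} (hw : w.IsPath) {u v : V}
    (h : (u, v) ∈ w.darts.map (·.toProd)) : (v, u) ∉ w.darts.map (·.toProd) := by
  intro h'
  obtain ⟨d, hd, hde⟩ := List.mem_map.1 h
  obtain ⟨e, he, hee⟩ := List.mem_map.1 h'
  have hnd : (w.darts.map SimpleGraph.Dart.edge).Nodup := hw.isTrail.edges_nodup
  have hedge : d.edge = e.edge := by
    rw [SimpleGraph.Dart.edge, SimpleGraph.Dart.edge, hde, hee, Sym2.eq_swap]
  have hdeq : d = e := List.inj_on_of_nodup_map hnd hd he hedge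
  have hadj := d.adj
  rw [hdeq, hee] at hde
  rw [Prod.mk.injEq] at hde
  have h1 : d.fst = d.snd := by
    rw [hdeq]
    rw [hee]
    exact hde.1
  exact hadj.ne h1

open Classical in
/-- The state after a unit payment along the feasible path `w`: for each step `(u, v)` of the path,
`c_{uv}` is incremented by one and `c_{vu}` is decremented by one. -/
noncomputable def pay (S : CreditState G c) {s t : V} (w : G.Walk s t)
    (hw : S.IsFeasiblePath w) : CreditState G c where
  cap u v :=
    if (u, v) ∈ w.darts.map (·.toProd) then S.cap u v + 1
    else if (v, u) ∈ w.darts.map (·.toProd) then S.cap u v - 1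
    else S.cap u v
  cap_add_cap u v huv := by
    have hsum := S.cap_add_cap u v huv
    have key : ∀ a b, (a, b) ∈ w.darts.map (·.toProd) → 0 < S.cap b a := by
      intro a b hab
      obtain ⟨d, hd, hde⟩ := List.mem_map.1 hab
      have := hw.2 d hd
      change 0 < S.cap d.toProd.2 d.toProd.1 at this
      rwa [hde] at this
    by_cases h1 : (u, v) ∈ w.darts.map (·.toProd)
    · have h2 := not_mem_darts_reverse hw.1 h1
      have := key u v h1
      rw [if_pos h1, if_neg h2, if_pos h1]
      omega
    · by_cases h2 : (v, u) ∈ w.darts.map (·.toProd)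
      · have := key v u h2
        rw [if_neg h1, if_pos h2, if_pos h2]
        omega
      · rw [if_neg h1, if_neg h2, if_neg h2, if_neg h1]
        exact hsum
  cap_eq_zero u v huv := by
    have h0 := S.cap_eq_zero u v huv
    have key : ∀ a b, (a, b) ∈ w.darts.map (·.toProd) → G.Adj a b := by
      intro a b hab
      obtain ⟨d, _, hde⟩ := List.mem_map.1 hab
      have := d.adj
      change G.Adj d.toProd.1 d.toProd.2 at this
      rwa [hde] at this
    rw [if_neg (fun h => huv (key u v h)), if_neg (fun h => huv (key v u h).symm), h0]

/-- Node `v` is bankrupt: no node currently extends any credit to it. -/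
def IsBankrupt (S : CreditState G c) (v : V) : Prop :=
  ∀ u, S.cap u v = 0

end CreditState

/-- A routing rule picks, for each state and each feasible transaction `(s, t)`, a shortest
feasible path from `s` to `t`; that is, it settles the ties between such paths. -/
def RoutingRule {V : Type*} (G : SimpleGraph V) (c : ℕ) : Type _ :=
  ∀ (S : CreditState G c) (s t : V), S.CanPay s t →
    {w : G.Walk s t // S.IsShortestFeasiblePath w}

open Classical in
/-- The state after the unit transaction `(s, t)` is attempted in state `S`: it is unchanged if the
transaction is infeasible. -/
noncomputable def nextState {V : Type*} {G : SimpleGraph V} {c : ℕ} (R : RoutingRule G c)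
    (S : CreditState G c) (s t : V) : CreditState G c :=
  if h : S.CanPay s t then S.pay (R S s t h).1 (R S s t h).2.1 else S

/-- `Λ` is a transaction rate matrix: `Λ s t` is the probability that at a time step the pair
(payer, payee) is `(s, t)`. -/
structure IsTransactionRate {V : Type*} [Fintype V] (Λ : Matrix V V ℝ) : Prop where
  nonneg : ∀ s t, 0 ≤ Λ s t
  diag : ∀ s, Λ s s = 0
  sum_eq_one : ∑ s, ∑ t, Λ s t = 1

open Classical in
/-- The transition matrix of the Markov chain of repeated transactions with rates `Λ`. -/
noncomputable def transitionMatrix {V : Type*} [Fintype V] {G : SimpleGraph V} {c : ℕ}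
    (R : RoutingRule G c) (Λ : Matrix V V ℝ) : Matrix (CreditState G c) (CreditState G c) ℝ :=
  Matrix.of fun S S' => ∑ s, ∑ t, if nextState R S s t = S' then Λ s t else 0

open Classical in
/-- A finite Markov chain is ergodic if it is irreducible and aperiodic; the latter means that for
each state the only common divisor of the possible return times is `1`. -/
def IsErgodicChain {X : Type*} [Fintype X] (P : Matrix X X ℝ) : Prop :=
  P.IsIrreducible ∧
    ∀ x, ∀ d : ℕ, (∀ k : ℕ, 0 < k → 0 < (P ^ k) x x → d ∣ k) → d = 1

/-- `π` is a stationary (steady-state) probability distribution of the chain `P`. -/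
def IsStationaryDistribution {X : Type*} [Fintype X] (P : Matrix X X ℝ) (π : X → ℝ) : Prop :=
  π ∈ stdSimplex ℝ X ∧ Matrix.vecMul π P = π

open Classical in
/-- The probability that node `v` is bankrupt under the distribution `π` on states. -/
noncomputable def bankruptcyProb {V : Type*} [Finite V] {G : SimpleGraph V} {c : ℕ}
    (π : CreditState G c → ℝ) (v : V) : ℝ :=
  ∑ S, if S.IsBankrupt v then π S else 0

/-! Call the total credit extended to a node its score. A payment moves one unit of score from payer
to payee and changes no other score. A cut argument (`CreditState.canPay_of_score`) shows that it is
feasible exactly when the resulting vector is the score of some state. So the chain projects to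
score vectors whatever the routing rule, and for symmetric rates the projected chain is symmetric:
in the steady state all score vectors are equally likely (`CreditState.sum_stationary_score_eq`).
Bankruptcy of `v` means score zero at `v`.

With every edge replaced by `c` parallel copies, score vectors are the in-degree vectors of
orientations. These are equinumerous with forests, because both counts obey the same
deletion-contraction recursion (`card_orientationScores`). Score zero at `v` fixes the direction of
every edge at `v`. Hence the bankruptcy probability is the probability that `v` is isolated in a
uniformly random forest (`bankruptcyProb_eq_forests`).

Upper bound: if `v` has degree `d` in the graph, it can be attached as a leaf to a forest avoiding
it in `c * d` ways, so isolation has probability at most `1 / (1 + c * d)`. By Chernoff, `d` is of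
order `n * p` outside an event of probability `O(1 / (n * p * c))`.

Lower bound: at least a third of the nodes of a forest have degree at most two, so by
exchangeability `v` has low degree with expected probability at least `1 / 3`. A forest with low
degree at `v` arises from one avoiding `v` by adding at most two edge copies at `v`; two can be
added only towards neighbours that the forest separates. With probability at least `5 / 6` the graph
without `v` is an expander. Then a random forest on it separates only `O(n / (p * c))` pairs on
average: many separated pairs would mean many edges that can be added, whereas forests have at most
`n` edges. The edges at `v` are independent of all this, so on average `O(n * p / c)` pairs of
neighbours are separated, and low degree is typically only `O(n * p * c)` times as likely as
isolation. -/

section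

open Finset

/-! ### In-degree vectors of orientations: exchange property and deletion-contraction. -/

section Scores

variable {V ι : Type*} [Fintype V] [DecidableEq V] [Fintype ι] [DecidableEq ι]

/-- The vector of an edge in the binary cycle-space representation of the graphic matroid. -/
def edgeVec : Sym2 V → V → ZMod 2 :=
  Sym2.lift ⟨fun x y => Pi.single x 1 + Pi.single y 1, fun _ _ => add_comm _ _⟩

omit [Fintype V] in
@[simp] theorem edgeVec_mk (x y : V) :
    edgeVec s(x, y) = Pi.single x (1 : ZMod 2) + Pi.single y 1 := rfl

/-- The in-degree vectors of the orientations of the multigraph with edges `e i`, `i ∈ I`, where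
`o i` is the head of the edge `e i`. -/
def orientationScores (I : Finset ι) (e : ι → Sym2 V) : Finset (V → ℕ) :=
  ({o : ι → V | ∀ i ∈ I, o i ∈ e i} : Finset (ι → V)).image fun o v => #{i ∈ I | o i = v}

theorem mem_orientationScores {I : Finset ι} {e : ι → Sym2 V} {s : V → ℕ} :
    s ∈ orientationScores I e ↔
      ∃ o : ι → V, (∀ i ∈ I, o i ∈ e i) ∧ ∀ v, #{i ∈ I | o i = v} = s v := by
  simp [orientationScores, funext_iff]

omit [Fintype V] [Fintype ι] in
/-- The exchange property of orientation scores. -/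
theorem exists_exchange (I : Finset ι) (e : ι → Sym2 V) (m : ℕ) :
    ∀ (o o' : ι → V) (a : V), (∀ i ∈ I, o i ∈ e i) → (∀ i ∈ I, o' i ∈ e i) →
      #{i ∈ I | o i ≠ o' i} = m → #{i ∈ I | o i = a} < #{i ∈ I | o' i = a} →
      ∃ b, b ≠ a ∧ #{i ∈ I | o' i = b} < #{i ∈ I | o i = b} ∧
        ∃ o'' : ι → V, (∀ i ∈ I, o'' i ∈ e i) ∧
          ∀ v, #{i ∈ I | o'' i = v} + (if v = b then 1 else 0) =
            #{i ∈ I | o i = v} + (if v = a then 1 else 0) := by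
  induction m using Nat.strong_induction_on with
  | _ m ih =>
  intro o o' a ho ho' hm hlt
  obtain ⟨i, hi, hia⟩ : ∃ i ∈ I, o' i = a ∧ o i ≠ a := by
    by_contra! h
    refine hlt.not_ge (card_le_card fun i hi => ?_)
    simp only [mem_filter] at hi ⊢
    exact ⟨hi.1, h i hi.1 hi.2⟩
  -- Redirecting `i` towards `a` costs `y` one unit. If `o` exceeds `o'` at `y`, then `b = y` works.
  -- Otherwise `y` is now deficient, and the argument repeats from `y` with fewer disagreements.
  set y := o i with hy
  set o₁ : ι → V := Function.update o i a with ho₁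
  have ho₁e : ∀ j ∈ I, o₁ j ∈ e j := by
    intro j hj
    by_cases hji : j = i
    · subst hji
      rw [ho₁, Function.update_self, ← hia.1]
      exact ho' j hj
    · rw [ho₁, Function.update_of_ne hji]
      exact ho j hj
  have hcount : ∀ v, #{j ∈ I | o₁ j = v} + (if v = y then 1 else 0) =
      #{j ∈ I | o j = v} + (if v = a then 1 else 0) := by
    intro v
    have key : ∀ f : ι → V, #{j ∈ I | f j = v} =
        #{j ∈ I.erase i | f j = v} + (if v = f i then 1 else 0) := by
      intro f
      conv_lhs => rw [← insert_erase hi]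
      rw [filter_insert]
      by_cases h : f i = v
      · rw [if_pos h, card_insert_of_notMem (by simp), if_pos h.symm]
      · rw [if_neg h, if_neg (Ne.symm h), add_zero]
    have heq : #{j ∈ I.erase i | o₁ j = v} = #{j ∈ I.erase i | o j = v} := by
      congr 1
      refine filter_congr fun j hj => ?_
      rw [ho₁, Function.update_of_ne (ne_of_mem_erase hj)]
    rw [key o₁, key o, heq, show o₁ i = a by simp [ho₁], ← hy]
    omega
  by_cases hyy : #{j ∈ I | o' j = y} < #{j ∈ I | o j = y}
  · exact ⟨y, hia.2, hyy, o₁, ho₁e, hcount⟩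
  · have hdis : #{j ∈ I | o₁ j ≠ o' j} < m := by
      rw [← hm]
      refine card_lt_card ?_
      rw [ssubset_iff_of_subset]
      · refine ⟨i, by simp [hi, hia.1, hia.2, ← hy], by simp [ho₁, hia.1]⟩
      · intro j hj
        simp only [mem_filter] at hj ⊢
        refine ⟨hj.1, ?_⟩
        by_cases hji : j = i
        · subst hji
          exact absurd hj.2 (by simp [ho₁, hia.1])
        · rw [ho₁, Function.update_of_ne hji] at hj
          exact hj.2
    have h1y := hcount y
    rw [if_pos rfl, if_neg hia.2] at h1y
    obtain ⟨b, hby, hb, o₂, ho₂, hc₂⟩ := ih _ hdis o₁ o' y ho₁e ho' rfl (by omega)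
    have h1b := hcount b
    rw [if_neg hby] at h1b
    -- `a` was deficient before it gained one unit, so it cannot be in excess now.
    have hba : b ≠ a := by
      rintro rfl
      rw [if_pos rfl] at h1b
      omega
    refine ⟨b, hba, ?_, o₂, ho₂, fun v => ?_⟩
    · rw [if_neg hba] at h1b
      omega
    · have h1 := hcount v
      have h2 := hc₂ v
      omega

/-- The scores of a fixed multigraph are closed under moving one unit towards another score that
differs only at two nodes. -/
theorem orientationScores_convex {I : Finset ι} {e : ι → Sym2 V} {s s' : V → ℕ} {a b : V}
    (hs : s ∈ orientationScores I e) (hs' : s' ∈ orientationScores I e)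
    (hsa : s a < s' a) (h : ∀ v, v ≠ a → v ≠ b → s v = s' v) :
    ∃ t ∈ orientationScores I e,
      ∀ v, t v + (if v = b then 1 else 0) = s v + (if v = a then 1 else 0) := by
  obtain ⟨o, ho, hos⟩ := mem_orientationScores.1 hs
  obtain ⟨o', ho', hos'⟩ := mem_orientationScores.1 hs'
  obtain ⟨b', hb'a, hb', o'', ho'', hc⟩ :=
    exists_exchange I e _ o o' a ho ho' rfl (by rw [hos, hos']; exact hsa)
  rw [hos, hos'] at hb'
  obtain rfl : b' = b := by
    by_contra hne
    exact hb'.ne' (h b' hb'a hne)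
  refine ⟨fun v => #{i ∈ I | o'' i = v}, mem_orientationScores.2 ⟨o'', ho'', fun _ => rfl⟩, ?_⟩
  intro v
  rw [hc, hos]

/-- The effect on a score of merging the node `b` into the node `a`. -/
def mergeScore (a b : V) (s : V → ℕ) : V → ℕ := fun v =>
  if v = a then s a + s b else if v = b then 0 else s v

/-- The map that merges the node `b` into the node `a`. -/
def mergeNode (a b : V) : V → V := fun v => if v = b then a else v

/-- Contraction acts on orientations through their heads: every head in the contracted graph lifts
to an endpoint of the original edge, and counting heads commutes with merging. -/
theorem orientationScores_merge {a b : V} (hab : a ≠ b) (J : Finset ι) (e : ι → Sym2 V) :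
    orientationScores J (fun i => Sym2.map (mergeNode a b) (e i)) =
      (orientationScores J e).image (mergeScore a b) := by
  have hcount : ∀ o : ι → V, (fun v => #{i ∈ J | mergeNode a b (o i) = v}) =
      mergeScore a b fun v => #{i ∈ J | o i = v} := by
    intro o
    funext v
    unfold mergeScore mergeNode
    by_cases hva : v = a
    · subst hva
      rw [if_pos rfl, ← card_union_of_disjoint, ← filter_or]
      · congr 1
        refine filter_congr fun i _ => ?_
        split_ifs with h
        · simp [h]
        · simp [h]
      · rw [disjoint_filter]
        rintro i _ rfl h
        exact hab h
    · rw [if_neg hva]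
      by_cases hvb : v = b
      · rw [if_pos hvb, card_eq_zero, filter_eq_empty_iff]
        intro i _
        split_ifs with h
        · exact Ne.symm hva
        · rw [hvb]; exact h
      · rw [if_neg hvb]
        congr 1
        refine filter_congr fun i _ => ?_
        split_ifs with h
        · rw [h]
          exact ⟨fun h' => absurd h'.symm hva, fun h' => absurd h'.symm hvb⟩
        · rfl
  ext s
  rw [mem_image]
  constructor
  · intro hs
    obtain ⟨o, ho, hos⟩ := mem_orientationScores.1 hs
    have : ∀ i, ∃ x, i ∈ J → x ∈ e i ∧ mergeNode a b x = o i := by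
      intro i
      by_cases hi : i ∈ J
      · obtain ⟨x, hx⟩ := Sym2.mem_map.1 (ho i hi)
        exact ⟨x, fun _ => hx⟩
      · exact ⟨a, fun h => absurd h hi⟩
    choose o' ho' using this
    refine ⟨fun v => #{i ∈ J | o' i = v},
      mem_orientationScores.2 ⟨o', fun i hi => (ho' i hi).1, fun _ => rfl⟩, ?_⟩
    rw [← hcount]
    funext v
    rw [← hos v]
    congr 1
    refine filter_congr fun i hi => ?_
    rw [(ho' i hi).2]
  · rintro ⟨t, ht, rfl⟩
    obtain ⟨o, ho, hot⟩ := mem_orientationScores.1 ht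
    refine mem_orientationScores.2 ⟨fun i => mergeNode a b (o i),
      fun i hi => Sym2.mem_map.2 ⟨_, ho i hi, rfl⟩, fun v => ?_⟩
    rw [← funext hot]
    exact congrFun (hcount o) v

theorem orientationScores_insert {J : Finset ι} {e : ι → Sym2 V} {i : ι} (hi : i ∉ J) {a b : V}
    (he : e i = s(a, b)) :
    orientationScores (insert i J) e =
      (orientationScores J e).image (fun s => s + Pi.single a 1) ∪
        (orientationScores J e).image (fun s => s + Pi.single b 1) := by
  have hcount : ∀ (o : ι → V) v, #{j ∈ insert i J | o j = v} =
      #{j ∈ J | o j = v} + (Pi.single (o i) 1 : V → ℕ) v := by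
    intro o v
    rw [filter_insert, Pi.single_apply]
    by_cases h : o i = v
    · rw [if_pos h, card_insert_of_notMem (by simp [hi]), if_pos h.symm]
    · rw [if_neg h, if_neg (Ne.symm h), add_zero]
  ext s
  rw [mem_union, mem_image, mem_image]
  constructor
  · intro hs
    obtain ⟨o, ho, hos⟩ := mem_orientationScores.1 hs
    have hm : (fun v => #{j ∈ J | o j = v}) ∈ orientationScores J e :=
      mem_orientationScores.2 ⟨o, fun j hj => ho j (mem_insert_of_mem hj), fun _ => rfl⟩
    have hoi := ho i (mem_insert_self i J)
    rw [he, Sym2.mem_iff] at hoi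
    rcases hoi with h | h
    · refine Or.inl ⟨_, hm, ?_⟩
      funext v
      rw [← hos v, hcount, h]
      rfl
    · refine Or.inr ⟨_, hm, ?_⟩
      funext v
      rw [← hos v, hcount, h]
      rfl
  · have key : ∀ x, x ∈ e i → ∀ t ∈ orientationScores J e,
        t + Pi.single x 1 ∈ orientationScores (insert i J) e := by
      intro x hx t ht
      obtain ⟨o, ho, hot⟩ := mem_orientationScores.1 ht
      refine mem_orientationScores.2 ⟨Function.update o i x, fun j hj => ?_, fun v => ?_⟩
      · by_cases hji : j = i
        · subst hji
          rwa [Function.update_self]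
        · rw [Function.update_of_ne hji]
          exact ho j ((mem_insert.1 hj).resolve_left hji)
      · rw [hcount, Function.update_self, Pi.add_apply, ← hot v]
        congr 2
        refine filter_congr fun j hj => ?_
        rw [Function.update_of_ne (ne_of_mem_of_not_mem hj hi)]
    rintro (⟨t, ht, rfl⟩ | ⟨t, ht, rfl⟩)
    · exact key a (by simp [he]) t ht
    · exact key b (by simp [he]) t ht

/-- With `X` the scores without `i`, the scores with `i` are the union of two translates of `X`. The
first has the size of `X`. The part of the second outside the first has one element for each merged
score, because `X` meets every fibre of the merge in an interval. -/
theorem card_orientationScores_insert {J : Finset ι} {e : ι → Sym2 V} {i : ι} (hi : i ∉ J)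
    {a b : V} (hab : a ≠ b) (he : e i = s(a, b)) :
    #(orientationScores (insert i J) e) = #(orientationScores J e) +
      #(orientationScores J fun i => Sym2.map (mergeNode a b) (e i)) := by
  set X := orientationScores J e with hX
  have hinj : ∀ x : V, Function.Injective fun s : V → ℕ => s + Pi.single x 1 :=
    fun x => add_left_injective _
  have hval : ∀ (s t : V → ℕ), t + Pi.single a 1 = s + Pi.single b 1 ↔
      t a + 1 = s a ∧ t b = s b + 1 ∧ ∀ v, v ≠ a → v ≠ b → t v = s v := by
    intro s t
    constructor
    · intro h
      have h' := fun v => congrFun h v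
      refine ⟨?_, ?_, fun v hva hvb => ?_⟩
      · simpa [Pi.single_apply, hab] using h' a
      · simpa [Pi.single_apply, hab.symm] using h' b
      · simpa [Pi.single_apply, hva, hvb] using h' v
    · rintro ⟨h1, h2, h3⟩
      funext v
      by_cases hva : v = a
      · subst hva; simpa [Pi.single_apply, hab] using h1
      · by_cases hvb : v = b
        · subst hvb; simpa [Pi.single_apply, hab.symm] using h2
        · simpa [Pi.single_apply, hva, hvb] using h3 v hva hvb
  have hmerge : ∀ s t : V → ℕ, mergeScore a b s = mergeScore a b t ↔
      s a + s b = t a + t b ∧ ∀ v, v ≠ a → v ≠ b → s v = t v := by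
    intro s t
    constructor
    · intro h
      refine ⟨by simpa [mergeScore] using congrFun h a, fun v hva hvb => ?_⟩
      simpa [mergeScore, hva, hvb] using congrFun h v
    · rintro ⟨h1, h2⟩
      funext v
      unfold mergeScore
      split_ifs with hva hvb
      · exact h1
      · rfl
      · exact h2 v hva hvb
  -- `Y` consists of the scores in `X` that leave `X` when one unit is moved from `a` to `b`: the
  -- upper ends, in the `b` coordinate, of the fibres of the merge.
  set Y := X.filter fun s => ∀ t ∈ X, t + Pi.single a 1 ≠ s + Pi.single b 1 with hY
  have hcardY : #(X.image (fun s => s + Pi.single b 1) \ X.image fun s => s + Pi.single a 1) =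
      #Y := by
    rw [← card_image_of_injective Y (hinj b)]
    congr 1
    ext s
    simp only [mem_sdiff, mem_image, hY, mem_filter]
    constructor
    · rintro ⟨⟨t, ht, rfl⟩, h⟩
      exact ⟨t, ⟨ht, fun u hu hut => h ⟨u, hu, hut⟩⟩, rfl⟩
    · rintro ⟨t, ⟨ht, h⟩, rfl⟩
      exact ⟨⟨t, ht, rfl⟩, fun ⟨u, hu, hut⟩ => h u hu hut⟩
  -- Every fibre that meets `X` has an element with maximal value at `b`, and that element lies in
  -- `Y`.
  have himg : Y.image (mergeScore a b) = X.image (mergeScore a b) := by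
    refine (image_subset_image (filter_subset _ _)).antisymm fun x hx => ?_
    obtain ⟨s, hs, rfl⟩ := mem_image.1 hx
    obtain ⟨t, ht, hmax⟩ := exists_max_image (X.filter fun t => mergeScore a b t = mergeScore a b s)
      (fun t => t b) ⟨s, by simp [hs]⟩
    rw [mem_filter] at ht
    refine mem_image.2 ⟨t, mem_filter.2 ⟨ht.1, fun u hu hut => ?_⟩, ht.2⟩
    obtain ⟨h1, h2, h3⟩ := (hval t u).1 hut
    have := hmax u (mem_filter.2 ⟨hu, ht.2 ▸ (hmerge u t).2 ⟨by omega, h3⟩⟩)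
    omega
  -- By convexity, if a fibre contains an element with a larger value at `b`, the unit can be moved
  -- within `X`; so two distinct members of `Y` never share a fibre.
  have hinjY : Set.InjOn (mergeScore a b) (Y : Set (V → ℕ)) := by
    have key : ∀ s ∈ Y, ∀ t ∈ Y, mergeScore a b s = mergeScore a b t → ¬ s b < t b := by
      intro s hs t ht hst hlt
      rw [hY, mem_filter] at hs ht
      obtain ⟨h1, h2⟩ := (hmerge s t).1 hst
      obtain ⟨u, hu, huv⟩ := orientationScores_convex hs.1 ht.1 hlt fun v hb ha => h2 v ha hb
      refine hs.2 u hu ((hval s u).2 ⟨?_, ?_, fun v hva hvb => ?_⟩)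
      · simpa [hab] using huv a
      · simpa [hab.symm] using huv b
      · simpa [hva, hvb] using huv v
    intro s hs t ht hst
    have h1 := key s hs t ht hst
    have h2 := key t ht s hs hst.symm
    obtain ⟨h3, h4⟩ := (hmerge s t).1 hst
    funext v
    by_cases hva : v = a
    · subst hva; omega
    · by_cases hvb : v = b
      · subst hvb; omega
      · exact h4 v hva hvb
  rw [orientationScores_insert hi he, union_comm, ← card_sdiff_add_card, ← hX, hcardY,
    card_image_of_injective _ (hinj a), orientationScores_merge hab, ← hX, ← himg,
    card_image_of_injOn hinjY, add_comm]

/-! ### Forests as independent sets over `ZMod 2`, with the same recursion. -/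

omit [Fintype ι] [DecidableEq ι] in
theorem linearIndepOn_insert_iff_comp {K M N : Type*} [Field K] [AddCommGroup M] [Module K M]
    [AddCommGroup N] [Module K N] {v : ι → M} {i : ι} {J : Set ι} (hi : i ∉ J) (f : M →ₗ[K] N)
    (hf : LinearMap.ker f = Submodule.span K {v i}) :
    LinearIndepOn K v (insert i J) ↔ v i ≠ 0 ∧ LinearIndepOn K (f ∘ v) J := by
  -- Contracting `v i` is passing to the quotient by its span, and `f` factors injectively through
  -- this quotient.
  have hmk : LinearIndepOn K (f ∘ v) J ↔
      LinearIndepOn K (Submodule.mkQ (Submodule.span K (v '' {i})) ∘ v) J := by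
    have hle : Submodule.span K (v '' {i}) ≤ LinearMap.ker f := by
      rw [hf, Set.image_singleton]
    have hker : LinearMap.ker ((Submodule.span K (v '' {i})).liftQ f hle) = ⊥ := by
      apply Submodule.ker_liftQ_eq_bot
      rw [hf, Set.image_singleton]
    exact LinearMap.linearIndependent_iff
      (v := fun x : J => (Submodule.mkQ (Submodule.span K (v '' {i})) ∘ v) x)
      ((Submodule.span K (v '' {i})).liftQ f hle) hker
  by_cases h0 : v i = 0
  · simp only [h0, ne_eq, not_true_eq_false, false_and, iff_false]
    intro h
    exact h.ne_zero (Set.mem_insert i J) h0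
  · have hs : LinearIndepOn K v {i} := LinearIndepOn.singleton h0
    rw [hmk, hs.quotient_iff_union (by simpa using hi), Set.singleton_union]
    simp [h0]

/-- The linear map on the binary node space that merges the node `b` into the node `a`. -/
def mergeVec (a b : V) : (V → ZMod 2) →ₗ[ZMod 2] (V → ZMod 2) where
  toFun x v := if v = a then x a + x b else if v = b then 0 else x v
  map_add' x y := by
    funext v
    simp only [Pi.add_apply]
    split_ifs <;> ring
  map_smul' r x := by
    funext v
    simp only [Pi.smul_apply, smul_eq_mul, RingHom.id_apply]
    split_ifs <;> ring

omit [Fintype V] in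
theorem mergeVec_edgeVec {a b : V} (hab : a ≠ b) (e : Sym2 V) :
    mergeVec a b (edgeVec e) = edgeVec (Sym2.map (mergeNode a b) e) := by
  have hsingle : ∀ x, mergeVec a b (Pi.single x 1) = Pi.single (mergeNode a b x) 1 := by
    intro x
    funext v
    simp only [mergeVec, mergeNode, LinearMap.coe_mk, AddHom.coe_mk, Pi.single_apply]
    by_cases hxb : x = b
    · subst hxb
      by_cases hva : v = a
      · simp [hva, hab]
      · by_cases hvb : v = x <;> simp [hva, hvb, hab]
    · by_cases hva : v = a
      · by_cases hxa : a = x <;> simp [hva, hxb, Ne.symm hxb, hxa]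
      · by_cases hvb : v = b
        · subst hvb
          simp [hva, hxb, Ne.symm hxb]
        · simp [hva, hvb, hxb]
  induction e using Sym2.ind with
  | _ x y => rw [edgeVec_mk, map_add, hsingle, hsingle, Sym2.map_mk, edgeVec_mk]

-- A vector is killed iff it vanishes off `a`, `b` and its values there cancel; in characteristic
-- two this means that they are equal.
omit [Fintype V] in
theorem ker_mergeVec {a b : V} (hab : a ≠ b) :
    LinearMap.ker (mergeVec a b) = Submodule.span (ZMod 2) {edgeVec s(a, b)} := by
  ext x
  rw [LinearMap.mem_ker, Submodule.mem_span_singleton]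
  constructor
  · intro h
    refine ⟨x a, ?_⟩
    have h' := fun v => congrFun h v
    simp only [mergeVec, LinearMap.coe_mk, AddHom.coe_mk, Pi.zero_apply] at h'
    have hab' := h' a
    rw [if_pos rfl] at hab'
    have hxab : x a = x b := by
      rw [eq_neg_of_add_eq_zero_left hab', ZModModule.neg_eq_self]
    funext v
    by_cases hva : v = a
    · subst hva; simp [hab]
    · by_cases hvb : v = b
      · subst hvb; simp [hva, hxab]
      · have := h' v
        rw [if_neg hva, if_neg hvb] at this
        simp [hva, hvb, this]
  · rintro ⟨r, rfl⟩
    rw [map_smul, mergeVec_edgeVec hab]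
    have : edgeVec (Sym2.map (mergeNode a b) s(a, b)) = 0 := by
      rw [Sym2.map_mk, edgeVec_mk]
      simp only [mergeNode, if_neg hab, if_pos]
      exact ZModModule.add_self _
    rw [this, smul_zero]

omit [Fintype V] in
theorem edgeVec_eq_zero_of_isDiag {e : Sym2 V} (he : e.IsDiag) : edgeVec e = 0 := by
  induction e using Sym2.ind with
  | _ x y =>
    rw [Sym2.mk_isDiag_iff] at he
    rw [he, edgeVec_mk]
    exact ZModModule.add_self _

omit [Fintype V] in
theorem edgeVec_ne_zero {a b : V} (hab : a ≠ b) : edgeVec s(a, b) ≠ 0 := by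
  intro h
  have := congrFun h a
  simp [hab] at this

omit [Fintype V] [Fintype ι] [DecidableEq ι] in
open Classical in
/-- The forests (independent sets of the graphic matroid) of the multigraph with edges `e i`. -/
noncomputable def forests (I : Finset ι) (e : ι → Sym2 V) : Finset (Finset ι) :=
  I.powerset.filter fun f => LinearIndepOn (ZMod 2) (edgeVec ∘ e) (f : Set ι)

omit [Fintype V] [Fintype ι] [DecidableEq ι] in
theorem mem_forests {I f : Finset ι} {e : ι → Sym2 V} :
    f ∈ forests I e ↔ f ⊆ I ∧ LinearIndepOn (ZMod 2) (edgeVec ∘ e) (f : Set ι) := by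
  simp [forests]

-- A forest either omits `i` or is `i` together with a forest of the contraction, since `mergeVec`
-- is the linear quotient by the vector of `i`.
omit [Fintype V] [Fintype ι] in
theorem card_forests_insert {J : Finset ι} {e : ι → Sym2 V} {i : ι} (hi : i ∉ J) {a b : V}
    (hab : a ≠ b) (he : e i = s(a, b)) :
    #(forests (insert i J) e) =
      #(forests J e) + #(forests J fun i => Sym2.map (mergeNode a b) (e i)) := by
  have hkey : ∀ f ⊆ J, LinearIndepOn (ZMod 2) (edgeVec ∘ e) (insert i f : Finset ι) ↔
      LinearIndepOn (ZMod 2) (edgeVec ∘ fun i => Sym2.map (mergeNode a b) (e i)) (f : Set ι) := by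
    intro f hf
    rw [coe_insert, linearIndepOn_insert_iff_comp (fun h => hi (hf (mem_coe.1 h))) (mergeVec a b)
      (by rw [ker_mergeVec hab, Function.comp_apply, he])]
    rw [Function.comp_apply, he, and_iff_right (edgeVec_ne_zero hab)]
    have : (mergeVec a b : (V → ZMod 2) → V → ZMod 2) ∘ edgeVec ∘ e =
        edgeVec ∘ fun i => Sym2.map (mergeNode a b) (e i) := by
      funext j
      exact mergeVec_edgeVec hab (e j)
    rw [this]
  have hunion : forests (insert i J) e = forests J e ∪
      (forests J fun i => Sym2.map (mergeNode a b) (e i)).image (insert i) := by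
    ext f
    rw [mem_union, mem_image, mem_forests, mem_forests]
    constructor
    · rintro ⟨hf, hfi⟩
      by_cases hif : i ∈ f
      · have hsub : f.erase i ⊆ J := by
          rwa [← subset_insert_iff]
        refine Or.inr ⟨f.erase i, mem_forests.2 ⟨hsub, ?_⟩, insert_erase hif⟩
        rwa [← hkey _ hsub, insert_erase hif]
      · exact Or.inl ⟨(subset_insert_iff_of_notMem hif).1 hf, hfi⟩
    · rintro (⟨hf, hfi⟩ | ⟨g, hg, rfl⟩)
      · exact ⟨hf.trans (subset_insert _ _), hfi⟩
      · rw [mem_forests] at hg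
        exact ⟨insert_subset_insert _ hg.1, (hkey g hg.1).2 hg.2⟩
  rw [hunion, card_union_of_disjoint, card_image_of_injOn]
  · intro f hf g hg hfg
    have hf' := fun h => hi ((mem_forests.1 (mem_coe.1 hf)).1 h)
    have hg' := fun h => hi ((mem_forests.1 (mem_coe.1 hg)).1 h)
    have := congrArg (fun s => s.erase i) hfg
    simpa [erase_insert hf', erase_insert hg'] using this
  · rw [disjoint_left]
    intro f hf hf'
    obtain ⟨g, _, rfl⟩ := mem_image.1 hf'
    exact hi ((mem_forests.1 hf).1 (mem_insert_self i g))

omit [Fintype V] [Fintype ι] in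
theorem forests_insert_of_isDiag {J : Finset ι} {e : ι → Sym2 V} {i : ι}
    (he : (e i).IsDiag) : forests (insert i J) e = forests J e := by
  ext f
  rw [mem_forests, mem_forests]
  refine ⟨fun ⟨hf, hfi⟩ => ⟨?_, hfi⟩, fun ⟨hf, hfi⟩ => ⟨hf.trans (subset_insert _ _), hfi⟩⟩
  refine (subset_insert_iff_of_notMem fun hif => ?_).1 hf
  exact hfi.ne_zero (mem_coe.2 hif) (edgeVec_eq_zero_of_isDiag he)

/-- The scores of a multigraph are equinumerous with its forests. -/
theorem card_orientationScores (I : Finset ι) (e : ι → Sym2 V) :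
    #(orientationScores I e) = #(forests I e) := by
  induction I using Finset.induction_on generalizing e with
  | empty =>
    have h1 : forests (∅ : Finset ι) e = {∅} := by
      ext f
      rw [mem_forests, subset_empty, mem_singleton, and_iff_left_iff_imp]
      rintro rfl
      simp
    have h2 : orientationScores (∅ : Finset ι) e = {0} := by
      ext s
      rw [mem_orientationScores, mem_singleton]
      constructor
      · rintro ⟨o, -, ho⟩
        funext v
        simpa using (ho v).symm
      · rintro rfl
        -- `V` may be empty, so a default head has to be taken from the edge itself.
        exact ⟨fun i => (e i).out.1, by simp, by simp⟩
    rw [h1, h2, card_singleton, card_singleton]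
  | insert i J hi ih =>
    obtain ⟨a, b, he⟩ : ∃ a b, e i = s(a, b) := by
      induction h : e i using Sym2.ind with
      | _ x y => exact ⟨x, y, rfl⟩
    -- A loop translates all scores and lies in no forest, so it changes neither count.
    by_cases hab : a = b
    · subst hab
      rw [orientationScores_insert hi he, union_self,
        card_image_of_injective _ (add_left_injective _), ih,
        forests_insert_of_isDiag (by rw [he]; simp)]
    · rw [card_orientationScores_insert hi hab he, card_forests_insert hi hab he, ih, ih]

end Scores

/-! ### Irreducible stochastic matrices: harmonic functions and stationary distributions. -/

section Stochastic

variable {X : Type*} [Fintype X] [DecidableEq X] {P : Matrix X X ℝ}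

theorem pow_mulVec_eq_self {h : X → ℝ} (hP : P.mulVec h = h) (k : ℕ) : (P ^ k).mulVec h = h := by
  induction k with
  | zero => simp
  | succ k ih => rw [pow_succ, ← Matrix.mulVec_mulVec, hP, ih]

theorem vecMul_pow_eq_self {h : X → ℝ} (hP : Matrix.vecMul h P = h) (k : ℕ) :
    Matrix.vecMul h (P ^ k) = h := by
  induction k with
  | zero => simp
  | succ k ih => rw [pow_succ, ← Matrix.vecMul_vecMul, ih, hP]

theorem pow_apply_nonneg (hP : P.IsIrreducible) (k : ℕ) (i j : X) : 0 ≤ (P ^ k) i j := by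
  induction k generalizing i j with
  | zero => rw [pow_zero, Matrix.one_apply]; split_ifs <;> norm_num
  | succ k ih =>
    rw [pow_succ, Matrix.mul_apply]
    exact sum_nonneg fun l _ => mul_nonneg (ih i l) (hP.nonneg l j)

/-- A harmonic function of an irreducible stochastic matrix is constant. -/
theorem harmonic_const (hP : P.IsIrreducible) (hrow : P.mulVec 1 = 1) {h : X → ℝ}
    (hh : P.mulVec h = h) (i j : X) : h i = h j := by
  have : Nonempty X := ⟨i⟩
  obtain ⟨m, hm⟩ := Finite.exists_max h
  suffices key : ∀ l, h l = h m by rw [key i, key j]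
  intro l
  obtain ⟨k, -, hk⟩ := (Matrix.isIrreducible_iff_exists_pow_pos hP.nonneg).1 hP m l
  -- The maximum at `m` is the `P ^ k`-average of `h`, so `h` is maximal wherever the weight is
  -- positive, in particular at `l`.
  have h1 : ∑ x, (P ^ k) m x * (h m - h x) = 0 := by
    have ha := congrFun (pow_mulVec_eq_self hh k) m
    have hb := congrFun (pow_mulVec_eq_self hrow k) m
    simp only [Matrix.mulVec, dotProduct, Pi.one_apply, mul_one] at ha hb
    simp only [mul_sub, sum_sub_distrib, ← sum_mul, ha, hb]
    ring
  have h2 := (sum_eq_zero_iff_of_nonneg fun x _ =>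
    mul_nonneg (pow_apply_nonneg hP k m x) (sub_nonneg.2 (hm x))).1 h1 l (mem_univ l)
  rcases mul_eq_zero.1 h2 with h3 | h3
  · exact absurd h3 hk.ne'
  · linarith

theorem stationary_pos (hP : P.IsIrreducible) {ν : X → ℝ} (h0 : ∀ i, 0 ≤ ν i)
    (hν : Matrix.vecMul ν P = ν) {i : X} (hi : 0 < ν i) (j : X) : 0 < ν j := by
  obtain ⟨k, -, hk⟩ := (Matrix.isIrreducible_iff_exists_pow_pos hP.nonneg).1 hP i j
  have h1 := congrFun (vecMul_pow_eq_self hν k) j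
  rw [← h1]
  simp only [Matrix.vecMul, dotProduct]
  exact (mul_pos hi hk).trans_le (single_le_sum (f := fun x => ν x * (P ^ k) x j)
    (fun x _ => mul_nonneg (h0 x) (pow_apply_nonneg hP k x j)) (mem_univ i))

omit [DecidableEq X] in
/-- The absolute value of a left fixed vector of a stochastic matrix is a left fixed vector. -/
theorem vecMul_abs (h0 : ∀ i j, 0 ≤ P i j) (hrow : P.mulVec 1 = 1) {ν : X → ℝ}
    (hν : Matrix.vecMul ν P = ν) : Matrix.vecMul |ν| P = |ν| := by
  have hle : ∀ j, |ν j| ≤ Matrix.vecMul |ν| P j := by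
    intro j
    conv_lhs => rw [← hν]
    simp only [Matrix.vecMul, dotProduct]
    refine (abs_sum_le_sum_abs _ _).trans (le_of_eq ?_)
    exact sum_congr rfl fun i _ => by rw [abs_mul, abs_of_nonneg (h0 i j)]; rfl
  have hsum : ∑ j, Matrix.vecMul |ν| P j = ∑ j, |ν j| := by
    simp only [Matrix.vecMul, dotProduct]
    rw [sum_comm]
    refine sum_congr rfl fun i _ => ?_
    have := congrFun hrow i
    simp only [Matrix.mulVec, dotProduct, Pi.one_apply, mul_one] at this
    rw [← mul_sum, this, mul_one]
    rfl
  funext j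
  exact (((sum_eq_sum_iff_of_le fun j _ => hle j).1 hsum.symm) j (mem_univ j)).symm

/-- An irreducible stochastic matrix has a unique stationary distribution. -/
theorem existsUnique_stationary [Nonempty X] (hP : P.IsIrreducible) (hrow : P.mulVec 1 = 1) :
    ∃! π : X → ℝ, IsStationaryDistribution P π := by
  -- The constant vector is a right null vector of `P - 1`, so this square matrix also has a left
  -- null vector.
  have hex : ∃ ν : X → ℝ, ν ≠ 0 ∧ Matrix.vecMul ν P = ν := by
    have h1 : ∃ w : X → ℝ, w ≠ 0 ∧ (P - 1).mulVec w = 0 :=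
      ⟨1, one_ne_zero, by rw [Matrix.sub_mulVec, hrow, Matrix.one_mulVec, sub_self]⟩
    obtain ⟨ν, hν0, hν⟩ := Matrix.exists_vecMul_eq_zero_iff.2 (Matrix.exists_mulVec_eq_zero_iff.1 h1)
    rw [Matrix.vecMul_sub, Matrix.vecMul_one, sub_eq_zero] at hν
    exact ⟨ν, hν0, hν⟩
  obtain ⟨ν, hν0, hν⟩ := hex
  have habs := vecMul_abs hP.nonneg hrow hν
  have hpos : 0 < ∑ i, |ν i| := by
    obtain ⟨i, hi⟩ := Function.ne_iff.1 hν0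
    exact (abs_pos.2 hi).trans_le
      (single_le_sum (f := fun i => |ν i|) (fun i _ => abs_nonneg _) (mem_univ i))
  have hπ : IsStationaryDistribution P ((∑ i, |ν i|)⁻¹ • |ν|) := by
    refine ⟨⟨fun i => mul_nonneg (inv_nonneg.2 hpos.le) (abs_nonneg _), ?_⟩, ?_⟩
    · simp only [Pi.smul_apply, smul_eq_mul, ← mul_sum, Pi.abs_apply]
      exact inv_mul_cancel₀ hpos.ne'
    · rw [Matrix.smul_vecMul, habs]
  refine ⟨(∑ i, |ν i|)⁻¹ • |ν|, hπ, ?_⟩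
  have huniq : ∀ π π' : X → ℝ, IsStationaryDistribution P π → IsStationaryDistribution P π' →
      ∀ i, ¬ π i < π' i := by
    intro π π' hπ hπ' i hi
    -- Twice the positive part of `d` is a nonnegative fixed vector that is positive at `i`, hence
    -- positive everywhere. Then `d` is positive everywhere although its entries sum to zero.
    set d := π' - π with hd
    have hdP : Matrix.vecMul d P = d := by rw [hd, Matrix.sub_vecMul, hπ.2, hπ'.2]
    have hdabs := vecMul_abs hP.nonneg hrow hdP
    have hp : Matrix.vecMul (|d| + d) P = |d| + d := by rw [Matrix.add_vecMul, hdP, hdabs]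
    have hp0 : ∀ j, 0 ≤ (|d| + d) j := fun j => by
      have := neg_abs_le (d j)
      simp only [Pi.add_apply, Pi.abs_apply]
      linarith
    have hdi : 0 < d i := by simp [hd, hi]
    have hall := stationary_pos hP hp0 hp (i := i) (by
      simp only [Pi.add_apply, Pi.abs_apply]
      have := abs_nonneg (d i)
      linarith)
    have hdpos : ∀ j, 0 < d j := by
      intro j
      by_contra hj
      have := hall j
      simp only [Pi.add_apply, Pi.abs_apply, abs_of_nonpos (not_lt.1 hj)] at this
      linarith
    have hsum : ∑ j, d j = 0 := by
      simp only [hd, Pi.sub_apply, sum_sub_distrib, hπ.1.2, hπ'.1.2, sub_self]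
    exact (sum_pos (fun j _ => hdpos j) univ_nonempty).ne' hsum
  intro π' hπ'
  funext i
  exact le_antisymm (not_lt.1 (huniq _ _ hπ hπ' i)) (not_lt.1 (huniq _ _ hπ' hπ i))

end Stochastic

/-! ### The chain on scores and its uniform steady state. -/

namespace CreditState

variable {V : Type*} [Fintype V] {G : SimpleGraph V} {c : ℕ}

/-- The total credit that is currently extended to the node `v`. -/
def score (S : CreditState G c) (v : V) : ℕ := ∑ u, S.cap u v

theorem isBankrupt_iff (S : CreditState G c) (v : V) : S.IsBankrupt v ↔ S.score v = 0 := by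
  simp [score, IsBankrupt]

variable [DecidableEq V]

omit [Fintype V] [DecidableEq V] in
theorem walk_cons_fst_notMem {s x t : V} {h : G.Adj s x} {p : G.Walk x t}
    (hp : (SimpleGraph.Walk.cons h p).IsPath) {u v : V} (huv : (u, v) ∈ p.darts.map (·.toProd)) :
    u ≠ s ∧ v ≠ s := by
  obtain ⟨d, hd, hde⟩ := List.mem_map.1 huv
  have hs := ((SimpleGraph.Walk.cons_isPath_iff h p).1 hp).2
  have h1 := p.dart_fst_mem_support_of_mem_darts hd
  have h2 := p.dart_snd_mem_support_of_mem_darts hd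
  change d.toProd.1 ∈ _ at h1
  change d.toProd.2 ∈ _ at h2
  rw [hde] at h1 h2
  exact ⟨fun h => hs (h ▸ h1), fun h => hs (h ▸ h2)⟩

/-- Flow conservation. In the induction the new first step is counted separately because the rest of
the path never returns to its start. -/
theorem path_flow {s t : V} (w : G.Walk s t) (hw : w.IsPath) (v : V) :
    (#{u | (u, v) ∈ w.darts.map (·.toProd)}) + (if v = s then 1 else 0) =
      (#{u | (v, u) ∈ w.darts.map (·.toProd)}) + (if v = t then 1 else 0) := by
  induction w with
  | nil => simp
  | @cons s x t h p ih =>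
    have ih := ih ((SimpleGraph.Walk.cons_isPath_iff h p).1 hw).1
    have hne := fun {u v : V} => walk_cons_fst_notMem (u := u) (v := v) hw
    have hin : (#{u | (u, v) ∈ (SimpleGraph.Walk.cons h p).darts.map (·.toProd)}) =
        (#{u | (u, v) ∈ p.darts.map (·.toProd)}) + (if v = x then 1 else 0) := by
      simp only [SimpleGraph.Walk.darts_cons, List.map_cons, List.mem_cons, Prod.mk.injEq]
      rw [filter_or, card_union_of_disjoint, add_comm]
      · congr 1
        split_ifs with hv
        · simp [hv, filter_eq']
        · simp [hv]
      · rw [disjoint_filter]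
        rintro u - ⟨rfl, -⟩ h'
        exact (hne h').1 rfl
    have hout : (#{u | (v, u) ∈ (SimpleGraph.Walk.cons h p).darts.map (·.toProd)}) =
        (#{u | (v, u) ∈ p.darts.map (·.toProd)}) + (if v = s then 1 else 0) := by
      simp only [SimpleGraph.Walk.darts_cons, List.map_cons, List.mem_cons, Prod.mk.injEq]
      rw [filter_or, card_union_of_disjoint, add_comm]
      · congr 1
        split_ifs with hv
        · simp [hv, filter_eq']
        · simp [hv]
      · rw [disjoint_filter]
        rintro u - ⟨rfl, -⟩ h'
        exact (hne h').1 rfl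
    rw [hin, hout]
    omega

/-- Inner nodes of the path gain and lose one unit; only the payer loses and only the payee gains.
-/
theorem score_pay (S : CreditState G c) {s t : V} (w : G.Walk s t) (hw : S.IsFeasiblePath w)
    (v : V) : (S.pay w hw).score v + (if v = s then 1 else 0) =
      S.score v + (if v = t then 1 else 0) := by
  have hflow := path_flow w hw.1 v
  have hpt : ∀ u, (S.pay w hw).cap u v +
      (if (v, u) ∈ w.darts.map (·.toProd) then 1 else 0) =
        S.cap u v + (if (u, v) ∈ w.darts.map (·.toProd) then 1 else 0) := by
    intro u
    by_cases h1 : (u, v) ∈ w.darts.map (·.toProd)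
    · have h2 := not_mem_darts_reverse hw.1 h1
      simp only [pay, if_pos h1, if_neg h2, add_zero]
    · by_cases h2 : (v, u) ∈ w.darts.map (·.toProd)
      · obtain ⟨d, hd, hde⟩ := List.mem_map.1 h2
        have hpos := hw.2 d hd
        change 0 < S.cap d.toProd.2 d.toProd.1 at hpos
        rw [hde] at hpos
        simp only [pay, if_neg h1, if_pos h2, add_zero]
        exact Nat.sub_add_cancel hpos
      · simp only [pay, if_neg h1, if_neg h2]
  have hsum := sum_congr rfl fun u (_ : u ∈ (univ : Finset V)) => hpt u
  rw [sum_add_distrib, sum_add_distrib, ← card_filter, ← card_filter] at hsum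
  unfold score
  omega

/-- A payment is feasible as soon as some state has the score that it would produce. -/
theorem canPay_of_score (S S' : CreditState G c) {s t : V}
    (h : ∀ v, S'.score v + (if v = s then 1 else 0) = S.score v + (if v = t then 1 else 0)) :
    S.CanPay s t := by
  classical
  by_contra hst
  -- `U` is the set of nodes reachable from `s` by feasible steps. If `t` is outside, no credit
  -- enters `U` from outside, so the scores in `U` have the minimal possible sum, `c` times the
  -- number of edges inside. But `S'` would have a sum smaller by one.
  set U : Finset V := {x | ∃ w : G.Walk s x, ∀ d ∈ w.darts, 0 < S.cap d.snd d.fst} with hU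
  have hsU : s ∈ U := by
    rw [hU, mem_filter]
    exact ⟨mem_univ _, SimpleGraph.Walk.nil, by simp⟩
  have htU : t ∉ U := by
    rw [hU, mem_filter]
    rintro ⟨-, w, hw⟩
    exact hst ⟨w.bypass, w.bypass_isPath, fun d hd => hw d (w.darts_bypass_subset_darts hd)⟩
  have hcut : ∀ x ∈ U, ∀ y ∉ U, S.cap y x = 0 := by
    intro x hx y hy
    by_contra hne
    have hadj : G.Adj x y := by
      by_contra hna
      exact hne (S.cap_eq_zero y x fun h => hna h.symm)
    rw [hU, mem_filter] at hx hy
    obtain ⟨-, w, hw⟩ := hx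
    refine hy ⟨mem_univ _, w.concat hadj, fun d hd => ?_⟩
    rw [SimpleGraph.Walk.darts_concat, List.concat_eq_append, List.mem_append,
      List.mem_singleton] at hd
    rcases hd with hd | rfl
    · exact hw d hd
    · exact Nat.pos_of_ne_zero hne
  have hinner : ∀ T : CreditState G c, 2 * ∑ x ∈ U, ∑ y ∈ U, T.cap y x =
      ∑ x ∈ U, ∑ y ∈ U, if G.Adj x y then c else 0 := by
    intro T
    rw [two_mul]
    conv_lhs => enter [2]; rw [sum_comm]
    rw [← sum_add_distrib]
    refine sum_congr rfl fun x _ => ?_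
    rw [← sum_add_distrib]
    refine sum_congr rfl fun y _ => ?_
    split_ifs with hxy
    · rw [add_comm]; exact T.cap_add_cap x y hxy
    · rw [T.cap_eq_zero x y hxy, T.cap_eq_zero y x fun h => hxy h.symm]
  have hS : ∑ x ∈ U, S.score x = ∑ x ∈ U, ∑ y ∈ U, S.cap y x := by
    refine sum_congr rfl fun x hx => ?_
    exact (sum_subset (subset_univ U) fun y _ hy => hcut x hx y hy).symm
  have hS' : ∑ x ∈ U, ∑ y ∈ U, S'.cap y x ≤ ∑ x ∈ U, S'.score x :=
    sum_le_sum fun x _ => sum_le_sum_of_subset (subset_univ U)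
  have hsum := sum_congr rfl fun v (_ : v ∈ U) => h v
  rw [sum_add_distrib, sum_add_distrib, sum_ite_eq' U s, sum_ite_eq' U t, if_pos hsU,
    if_neg htU] at hsum
  have h1 := hinner S
  have h2 := hinner S'
  omega

theorem score_nextState (R : RoutingRule G c) (S : CreditState G c) (s t : V) :
    (S.CanPay s t → ∀ v, (nextState R S s t).score v + (if v = s then 1 else 0) =
      S.score v + (if v = t then 1 else 0)) ∧
    (¬ S.CanPay s t → nextState R S s t = S) := by
  unfold nextState
  refine ⟨fun h => ?_, fun h => by rw [dif_neg h]⟩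
  rw [dif_pos h]
  exact S.score_pay _ _

/-- Feasibility and the effect of a transaction depend only on the score, so the score process is
itself a Markov chain, independent of the choice of paths. -/
theorem score_nextState_congr (R : RoutingRule G c) {S T : CreditState G c}
    (h : S.score = T.score) (s t : V) :
    (nextState R S s t).score = (nextState R T s t).score := by
  by_cases hS : S.CanPay s t
  · have h1 := (score_nextState R S s t).1 hS
    have hT : T.CanPay s t := T.canPay_of_score _ fun v => by rw [h1 v, h]
    have h2 := (score_nextState R T s t).1 hT
    funext v
    have := h1 v
    have := h2 v
    rw [h] at *
    omega
  · have hT : ¬ T.CanPay s t := fun hT =>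
      hS (S.canPay_of_score _ fun v => by rw [(score_nextState R T s t).1 hT v, h])
    rw [(score_nextState R S s t).2 hS, (score_nextState R T s t).2 hT, h]

/-- A change of score rules out an infeasible transaction; conversely the target state `T` itself
certifies feasibility. -/
theorem score_nextState_eq_iff (R : RoutingRule G c) {S T : CreditState G c}
    (h : S.score ≠ T.score) (s t : V) :
    (nextState R S s t).score = T.score ↔
      ∀ v, T.score v + (if v = s then 1 else 0) = S.score v + (if v = t then 1 else 0) := by
  constructor
  · intro hn
    by_cases hS : S.CanPay s t
    · rw [← hn]
      exact (score_nextState R S s t).1 hS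
    · rw [(score_nextState R S s t).2 hS] at hn
      exact absurd hn h
  · intro hT
    have h1 := (score_nextState R S s t).1 (S.canPay_of_score T hT)
    funext v
    have := h1 v
    have := hT v
    omega

/-- The transition rates between score classes are symmetric. -/
theorem rate_symm (R : RoutingRule G c) {Λ : Matrix V V ℝ} (hΛ : Λ.IsSymm)
    (S T : CreditState G c) :
    ∑ s, ∑ t, (if (nextState R S s t).score = T.score then Λ s t else 0) =
      ∑ s, ∑ t, if (nextState R T s t).score = S.score then Λ s t else 0 := by
  by_cases h : S.score = T.score
  · simp only [score_nextState_congr R h, h]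
  -- Between distinct scores, `(s, t)` leads from `S` to `T` iff `(t, s)` leads back.
  · conv_rhs => rw [sum_comm]
    refine sum_congr rfl fun s _ => sum_congr rfl fun t _ => ?_
    rw [hΛ.apply]
    refine if_congr ?_ rfl rfl
    rw [score_nextState_eq_iff R h, score_nextState_eq_iff R (Ne.symm h)]
    exact ⟨fun h v => (h v).symm, fun h v => (h v).symm⟩

omit [DecidableEq V] in
theorem transitionMatrix_mulVec (R : RoutingRule G c) (Λ : Matrix V V ℝ)
    (h : CreditState G c → ℝ) (S : CreditState G c) :
    (transitionMatrix R Λ).mulVec h S = ∑ s, ∑ t, Λ s t * h (nextState R S s t) := by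
  simp only [transitionMatrix, Matrix.mulVec, dotProduct, Matrix.of_apply, sum_mul]
  rw [sum_comm]
  refine sum_congr rfl fun s _ => ?_
  rw [sum_comm]
  refine sum_congr rfl fun t _ => ?_
  rw [sum_eq_single (nextState R S s t)]
  · rw [if_pos rfl]
  · intro T _ hT
    rw [if_neg (Ne.symm hT), zero_mul]
  · exact fun h => absurd (mem_univ _) h

omit [DecidableEq V] in
theorem transitionMatrix_mulVec_one (R : RoutingRule G c) {Λ : Matrix V V ℝ}
    (hΛ : IsTransactionRate Λ) : (transitionMatrix R Λ).mulVec 1 = 1 := by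
  funext S
  rw [transitionMatrix_mulVec]
  simpa using hΛ.sum_eq_one

/-- The scores of the states of a credit network. -/
noncomputable def scores (G : SimpleGraph V) (c : ℕ) : Finset (V → ℕ) :=
  univ.image (score : CreditState G c → V → ℕ)

/-- In the steady state all scores are equally likely. -/
theorem sum_stationary_score_eq (R : RoutingRule G c) {Λ : Matrix V V ℝ}
    (hΛ : IsTransactionRate Λ) (hsymm : Λ.IsSymm)
    (hirr : (transitionMatrix R Λ).IsIrreducible) {π : CreditState G c → ℝ}
    (hπ : IsStationaryDistribution (transitionMatrix R Λ) π) (S T : CreditState G c) :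
    ∑ U with U.score = S.score, π U = ∑ U with U.score = T.score, π U := by
  classical
  -- Viewed as a function on states, the mass of the score class is harmonic: stationarity writes it
  -- as inflow over classes, and the symmetry of the rates turns inflow into an average over the
  -- next state.
  refine harmonic_const hirr (transitionMatrix_mulVec_one R hΛ)
    (h := fun S => ∑ U with U.score = S.score, π U) ?_ S T
  funext S
  have hstat : ∀ W, π W = ∑ U, π U * ∑ s, ∑ t, if nextState R U s t = W then Λ s t else 0 := by
    intro W
    conv_lhs => rw [← hπ.2]
    simp only [Matrix.vecMul, dotProduct, transitionMatrix, Matrix.of_apply]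
  rw [transitionMatrix_mulVec]
  symm
  calc ∑ W with W.score = S.score, π W
      = ∑ W with W.score = S.score, ∑ U, π U *
          ∑ s, ∑ t, (if nextState R U s t = W then Λ s t else 0) :=
        sum_congr rfl fun W _ => hstat W
    _ = ∑ U, π U * ∑ s, ∑ t, if (nextState R U s t).score = S.score then Λ s t else 0 := by
        rw [sum_comm]
        refine sum_congr rfl fun U _ => ?_
        rw [← mul_sum, sum_comm]
        congr 1
        refine sum_congr rfl fun s _ => ?_
        rw [sum_comm]
        refine sum_congr rfl fun t _ => ?_
        rw [sum_ite_eq]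
        simp
    _ = ∑ U, π U * ∑ s, ∑ t, if (nextState R S s t).score = U.score then Λ s t else 0 := by
        refine sum_congr rfl fun U _ => ?_
        rw [rate_symm R hsymm U S]
    _ = ∑ s, ∑ t, Λ s t * ∑ U with U.score = (nextState R S s t).score, π U := by
        simp only [mul_sum]
        rw [sum_comm]
        refine sum_congr rfl fun s _ => ?_
        rw [sum_comm]
        refine sum_congr rfl fun t _ => ?_
        rw [sum_filter]
        refine sum_congr rfl fun U _ => ?_
        by_cases h : (nextState R S s t).score = U.score
        · rw [if_pos h, if_pos h.symm, mul_comm]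
        · rw [if_neg h, if_neg (Ne.symm h), mul_zero]

/-- All scores carry the same mass and bankruptcy depends only on the score, so its probability is a
proportion of scores. -/
theorem bankruptcyProb_eq_card_div (R : RoutingRule G c) {Λ : Matrix V V ℝ}
    (hΛ : IsTransactionRate Λ) (hsymm : Λ.IsSymm)
    (hirr : (transitionMatrix R Λ).IsIrreducible) {π : CreditState G c → ℝ}
    (hπ : IsStationaryDistribution (transitionMatrix R Λ) π) (v : V) :
    bankruptcyProb π v = (#{x ∈ scores G c | x v = 0} : ℝ) / #(scores G c) := by
  set μ : (V → ℕ) → ℝ := fun x => ∑ U with U.score = x, π U with hμ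
  have hfib : ∀ (q : (V → ℕ) → Prop) [DecidablePred q], ∑ U : CreditState G c with q U.score, π U =
      ∑ x ∈ scores G c with q x, μ x := by
    intro q _
    rw [← sum_fiberwise_of_maps_to (s := univ.filter fun U : CreditState G c => q U.score)
      (t := {x ∈ scores G c | q x}) (g := score)]
    · refine sum_congr rfl fun x hx => ?_
      rw [hμ, filter_filter]
      refine sum_congr (filter_congr fun U _ => ?_) fun _ _ => rfl
      refine ⟨fun h => h.2, fun h => ⟨?_, h⟩⟩
      rw [h]
      exact (mem_filter.1 hx).2
    · intro U hU
      exact mem_filter.2 ⟨mem_image_of_mem _ (mem_univ U), (mem_filter.1 hU).2⟩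
  have hconst : ∃ m, ∀ x ∈ scores G c, μ x = m := by
    rcases (scores G c).eq_empty_or_nonempty with h | ⟨x, hx⟩
    · exact ⟨0, by simp [h]⟩
    · refine ⟨μ x, fun y hy => ?_⟩
      obtain ⟨S, -, rfl⟩ := mem_image.1 hx
      obtain ⟨T, -, rfl⟩ := mem_image.1 hy
      exact sum_stationary_score_eq R hΛ hsymm hirr hπ T S
  obtain ⟨m, hm⟩ := hconst
  have htot : (#(scores G c) : ℝ) * m = 1 := by
    have h1 := hfib fun _ => True
    rw [filter_true, filter_true, hπ.1.2,
      sum_congr rfl hm, sum_const, nsmul_eq_mul] at h1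
    exact h1.symm
  have hb : bankruptcyProb π v = ∑ U : CreditState G c with U.score v = 0, π U := by
    rw [bankruptcyProb, sum_filter]
    refine sum_congr rfl fun U _ => ?_
    simp only [isBankrupt_iff]
  rw [hb, hfib fun x => x v = 0, sum_congr rfl fun x hx => hm x (mem_filter.1 hx).1, sum_const,
    nsmul_eq_mul, eq_div_iff (left_ne_zero_of_mul_eq_one htot)]
  linear_combination (#{x ∈ scores G c | x v = 0} : ℝ) * htot

end CreditState

/-! ### From credit states to forests of the `c`-fold multigraph. -/

section CreditForests

variable {V : Type*} [Fintype V] [DecidableEq V] {c : ℕ}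

/-- The forests of the multigraph in which every edge of `E` is repeated `c` times. -/
noncomputable def creditForests (c : ℕ) (E : Finset (Sym2 V)) : Finset (Finset (Sym2 V × Fin c)) :=
  forests (E ×ˢ univ) Prod.fst

theorem card_head_eq (E : Finset (Sym2 V)) (o : Sym2 V × Fin c → V)
    (ho : ∀ x ∈ E ×ˢ (univ : Finset (Fin c)), o x ∈ x.1) (v : V) :
    #{x ∈ E ×ˢ (univ : Finset (Fin c)) | o x = v} =
      ∑ u, if s(u, v) ∈ E then #{i | o (s(u, v), i) = v} else 0 := by
  rw [card_filter, sum_product]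
  simp only [← card_filter]
  rw [← sum_filter, ← sum_image (s := univ.filter fun u => s(u, v) ∈ E)
    (f := fun e => #{i | o (e, i) = v}) fun a _ b _ h => Sym2.congr_left.1 h]
  symm
  refine sum_subset ?_ ?_
  · intro e he
    obtain ⟨u, hu, rfl⟩ := mem_image.1 he
    exact (mem_filter.1 hu).2
  · intro e he hne
    rw [card_eq_zero, filter_eq_empty_iff]
    intro i _ hi
    have hv : v ∈ e := hi ▸ ho (e, i) (mem_product.2 ⟨he, mem_univ i⟩)
    obtain ⟨u, rfl⟩ := Sym2.mem_iff_exists.1 hv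
    refine hne (mem_image.2 ⟨u, mem_filter.2 ⟨mem_univ u, ?_⟩, Sym2.eq_swap⟩)
    rwa [Sym2.eq_swap]

/-- The dictionary: `cap u v` is the number of copies of the edge `uv` with head `v`. -/
theorem scores_eq_orientationScores {G : SimpleGraph V} {E : Finset (Sym2 V)}
    (hE : ∀ e, e ∈ E ↔ e ∈ G.edgeSet) :
    CreditState.scores G c =
      orientationScores (E ×ˢ (univ : Finset (Fin c))) Prod.fst := by
  have hadj : ∀ u v, s(u, v) ∈ E ↔ G.Adj u v := fun u v => by
    rw [hE, SimpleGraph.mem_edgeSet]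
  ext x
  constructor
  · intro hx
    obtain ⟨S, -, rfl⟩ := mem_image.1 hx
    -- With the endpoints ordered by `Quot.out`, the copies of smallest index point to the first
    -- endpoint, as many as the state prescribes, and the others to the second.
    set o : Sym2 V × Fin c → V := fun y =>
      if (y.2 : ℕ) < S.cap y.1.out.2 y.1.out.1 then y.1.out.1 else y.1.out.2 with ho
    have hoE : ∀ y, o y ∈ y.1 := by
      intro y
      simp only [ho]
      split_ifs
      · exact Sym2.out_fst_mem _
      · exact Sym2.out_snd_mem _
    refine mem_orientationScores.2 ⟨o, fun y _ => hoE y, fun v => ?_⟩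
    rw [card_head_eq E o (fun y _ => hoE y) v]
    refine sum_congr rfl fun u _ => ?_
    by_cases huv : G.Adj u v
    · rw [if_pos ((hadj u v).2 huv)]
      have hlt : ∀ k ≤ c, #{i : Fin c | (i : ℕ) < k} = k := fun k hk => by
        rw [Fin.card_filter_val_lt, min_eq_right hk]
      have hout : s((s(u, v)).out.1, (s(u, v)).out.2) = s(u, v) := Quot.out_eq _
      rw [Sym2.eq_iff] at hout
      rcases hout with ⟨h1, h2⟩ | ⟨h1, h2⟩
      · have : #{i : Fin c | o (s(u, v), i) = v} = #{i : Fin c | ¬ (i : ℕ) < S.cap v u} := by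
          congr 1
          refine filter_congr fun i _ => ?_
          simp only [ho, h1, h2]
          split_ifs with h
          · simp [h, huv.ne]
          · simp [h]
        rw [this]
        have h3 := card_filter_add_card_filter_not (s := (univ : Finset (Fin c)))
          (fun i => (i : ℕ) < S.cap v u)
        rw [hlt _ (S.cap_le v u), card_univ, Fintype.card_fin] at h3
        have := S.cap_add_cap u v huv
        omega
      · rw [← hlt _ (S.cap_le u v)]
        congr 1
        refine filter_congr fun i _ => ?_
        simp only [ho, h1, h2]
        split_ifs with h
        · simp [h]
        · simp [h, huv.ne]
    · rw [if_neg fun h => huv ((hadj u v).1 h), S.cap_eq_zero u v huv]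
  · intro hx
    obtain ⟨o, ho, hox⟩ := mem_orientationScores.1 hx
    classical
    let S : CreditState G c :=
      { cap := fun u v => if s(u, v) ∈ E then #{i | o (s(u, v), i) = v} else 0
        cap_add_cap := by
          intro u v huv
          have hvu : s(v, u) = s(u, v) := Sym2.eq_swap
          rw [hvu, if_pos ((hadj u v).2 huv), if_pos ((hadj u v).2 huv),
            ← card_union_of_disjoint, ← filter_or, filter_true_of_mem, card_univ, Fintype.card_fin]
          · intro i _
            have := ho (s(u, v), i) (mem_product.2 ⟨(hadj u v).2 huv, mem_univ i⟩)
            rw [Sym2.mem_iff] at this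
            exact this.symm
          · rw [disjoint_filter]
            intro i _ h1 h2
            exact huv.ne (h2.symm.trans h1)
        cap_eq_zero := by
          intro u v huv
          rw [if_neg fun h => huv ((hadj u v).1 h)] }
    refine mem_image.2 ⟨S, mem_univ S, funext fun v => ?_⟩
    rw [← hox v, card_head_eq E o ho v]
    rfl

/-- Score zero at `v` forces every edge at `v` to point to its other endpoint. These edges then
contribute a fixed vector, and translation by it is the bijection. -/
theorem card_orientationScores_eq_zero {ι : Type*} [Fintype ι] [DecidableEq ι] {I : Finset ι}
    {e : ι → Sym2 V} (hI : ∀ i ∈ I, ¬ (e i).IsDiag) (v : V) :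
    #{x ∈ orientationScores I e | x v = 0} =
      #(orientationScores {i ∈ I | v ∉ e i} e) := by
  have hother : ∀ i, ∃ w, i ∈ I → v ∈ e i → e i = s(v, w) ∧ w ≠ v := by
    intro i
    by_cases hi : i ∈ I ∧ v ∈ e i
    · obtain ⟨w, hw⟩ := Sym2.mem_iff_exists.1 hi.2
      refine ⟨w, fun _ _ => ⟨hw, ?_⟩⟩
      rintro rfl
      exact hI i hi.1 (by rw [hw]; simp)
    · exact ⟨v, fun h1 h2 => absurd ⟨h1, h2⟩ hi⟩
  choose w hw using hother
  have hsplit : ∀ (o : ι → V) u, #{i ∈ I | o i = u} =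
      #{i ∈ {i ∈ I | v ∉ e i} | o i = u} + #{i ∈ {i ∈ I | v ∈ e i} | o i = u} := by
    intro o u
    rw [add_comm, filter_filter, filter_filter, ← card_filter_add_card_filter_not (fun i => v ∈ e i),
      filter_filter, filter_filter]
    congr 2 <;> exact filter_congr fun i _ => and_comm
  rw [← card_image_of_injective (orientationScores {i ∈ I | v ∉ e i} e)
    (add_left_injective fun u => #{i ∈ {i ∈ I | v ∈ e i} | w i = u})]
  congr 1
  ext x
  rw [mem_filter, mem_image]
  constructor
  · rintro ⟨hx, hxv⟩
    obtain ⟨o, ho, hox⟩ := mem_orientationScores.1 hx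
    refine ⟨fun u => #{i ∈ {i ∈ I | v ∉ e i} | o i = u},
      mem_orientationScores.2 ⟨o, fun i hi => ho i (mem_filter.1 hi).1, fun _ => rfl⟩, ?_⟩
    funext u
    rw [← hox u, hsplit, Pi.add_apply]
    congr 2
    refine filter_congr fun i hi => ?_
    rw [mem_filter] at hi
    have h1 := ho i hi.1
    rw [(hw i hi.1 hi.2).1, Sym2.mem_iff] at h1
    have h2 : o i ≠ v := by
      have := hox v
      rw [hxv, card_eq_zero, filter_eq_empty_iff] at this
      exact this hi.1
    rw [h1.resolve_left h2]
  · rintro ⟨y, hy, rfl⟩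
    obtain ⟨o, ho, hoy⟩ := mem_orientationScores.1 hy
    constructor
    · refine mem_orientationScores.2 ⟨fun i => if v ∈ e i then w i else o i, fun i hi => ?_,
        fun u => ?_⟩
      · beta_reduce
        split_ifs with h
        · rw [(hw i hi h).1]
          exact Sym2.mem_mk_right _ _
        · exact ho i (mem_filter.2 ⟨hi, h⟩)
      · rw [hsplit, Pi.add_apply, ← hoy u]
        congr 2
        · exact filter_congr fun i hi => by rw [if_neg (mem_filter.1 hi).2]
        · exact filter_congr fun i hi => by rw [if_pos (mem_filter.1 hi).2]
    · rw [Pi.add_apply, ← hoy v, Nat.add_eq_zero_iff, card_eq_zero, card_eq_zero,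
        filter_eq_empty_iff, filter_eq_empty_iff]
      constructor
      · intro i hi h
        exact (mem_filter.1 hi).2 (h ▸ ho i hi)
      · intro i hi
        rw [mem_filter] at hi
        exact (hw i hi.1 hi.2).2

omit [Fintype V] in
theorem card_creditForests_pos (c : ℕ) (E : Finset (Sym2 V)) : 0 < #(creditForests c E) :=
  card_pos.2 ⟨∅, mem_forests.2 ⟨empty_subset _, by simp⟩⟩

theorem nonempty_creditState (G : SimpleGraph V) (c : ℕ) : Nonempty (CreditState G c) := by
  classical
  have h := card_creditForests_pos c (univ.filter fun e => e ∈ G.edgeSet)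
  rw [creditForests, ← card_orientationScores,
    ← scores_eq_orientationScores (G := G) (by simp), card_pos] at h
  obtain ⟨x, hx⟩ := h
  obtain ⟨S, -, -⟩ := mem_image.1 hx
  exact ⟨S⟩

/-- The steady-state bankruptcy probability of `v` is the probability that `v` is isolated in a
uniformly random forest. -/
theorem bankruptcyProb_eq_forests {G : SimpleGraph V} {E : Finset (Sym2 V)}
    (hE : ∀ e, e ∈ E ↔ e ∈ G.edgeSet) (R : RoutingRule G c) {Λ : Matrix V V ℝ}
    (hΛ : IsTransactionRate Λ) (hsymm : Λ.IsSymm)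
    (hirr : (transitionMatrix R Λ).IsIrreducible) {π : CreditState G c → ℝ}
    (hπ : IsStationaryDistribution (transitionMatrix R Λ) π) (v : V) :
    bankruptcyProb π v =
      (#(creditForests c {e ∈ E | v ∉ e}) : ℝ) / #(creditForests c E) := by
  rw [CreditState.bankruptcyProb_eq_card_div R hΛ hsymm hirr hπ v,
    scores_eq_orientationScores hE, card_orientationScores_eq_zero, card_orientationScores,
    card_orientationScores, creditForests, creditForests]
  · have : ({i ∈ E ×ˢ (univ : Finset (Fin c)) | v ∉ i.1}) = {e ∈ E | v ∉ e} ×ˢ univ := by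
      ext i
      simp
    rw [this]
  · intro i hi
    exact G.not_isDiag_of_mem_edgeSet ((hE _).1 (mem_product.1 hi).1)

end CreditForests

/-! ### Counting forests by their edges at a node, and across components. -/

section ForestCounting

variable {V : Type*} [Fintype V] [DecidableEq V] {c : ℕ}

/-- The degree of the node `v` in a set of (labelled) edges. -/
def edgeDeg (f : Finset (Sym2 V × Fin c)) (v : V) : ℕ := #{x ∈ f | v ∈ x.1}

/-- The set of edges `f` does not connect the nodes `a` and `b`. -/
def Separates (f : Finset (Sym2 V × Fin c)) (a b : V) : Prop :=
  edgeVec s(a, b) ∉ Submodule.span (ZMod 2) ((edgeVec ∘ Prod.fst) '' (f : Set (Sym2 V × Fin c)))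

omit [Fintype V] in
theorem edgeVec_add (a b d : V) : edgeVec s(a, b) + edgeVec s(b, d) = edgeVec s(a, d) := by
  rw [edgeVec_mk, edgeVec_mk, edgeVec_mk, add_add_add_comm, add_assoc, ← add_assoc (Pi.single b 1),
    ZModModule.add_self, zero_add]

omit [Fintype V] in
theorem Separates.symm {f : Finset (Sym2 V × Fin c)} {a b : V} (h : Separates f a b) :
    Separates f b a := by
  rwa [Separates, Sym2.eq_swap]

omit [Fintype V] in
theorem not_separates_self (f : Finset (Sym2 V × Fin c)) (a : V) : ¬ Separates f a a := by
  rw [Separates, edgeVec_eq_zero_of_isDiag (by simp), not_not]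
  exact zero_mem _

omit [Fintype V] in
theorem not_separates_trans {f : Finset (Sym2 V × Fin c)} {a b d : V} (h1 : ¬ Separates f a b)
    (h2 : ¬ Separates f b d) : ¬ Separates f a d := by
  rw [Separates, not_not] at *
  rw [← edgeVec_add a b d]
  exact add_mem h1 h2

omit [Fintype V] in
theorem mem_creditForests {E : Finset (Sym2 V)} {f : Finset (Sym2 V × Fin c)} :
    f ∈ creditForests c E ↔ (∀ x ∈ f, x.1 ∈ E) ∧
      LinearIndepOn (ZMod 2) (edgeVec ∘ Prod.fst) (f : Set (Sym2 V × Fin c)) := by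
  rw [creditForests, mem_forests]
  simp [subset_iff]

omit [Fintype V] in
theorem creditForests_mono {E E' : Finset (Sym2 V)} (h : E ⊆ E') :
    creditForests c E ⊆ creditForests c E' := fun f hf => by
  rw [mem_creditForests] at *
  exact ⟨fun x hx => h (hf.1 x hx), hf.2⟩

omit [Fintype V] in
theorem creditForests_of_subset {E E' : Finset (Sym2 V)} {f g : Finset (Sym2 V × Fin c)}
    (hf : f ∈ creditForests c E) (hg : g ⊆ f) (hE' : ∀ x ∈ g, x.1 ∈ E') :
    g ∈ creditForests c E' := by
  rw [mem_creditForests] at *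
  exact ⟨hE', hf.2.mono (coe_subset.2 hg)⟩

theorem card_le_of_mem_creditForests {E : Finset (Sym2 V)} {f : Finset (Sym2 V × Fin c)}
    (hf : f ∈ creditForests c E) : #f ≤ Fintype.card V := by
  have h := (mem_creditForests.1 hf).2
  have h1 := h.linearIndependent.fintype_card_le_finrank
  simpa using h1

omit [Fintype V] in
/-- Adding an edge between two components of a forest gives a forest. -/
theorem insert_mem_creditForests {E : Finset (Sym2 V)} {g : Finset (Sym2 V × Fin c)}
    (hg : g ∈ creditForests c E) {a b : V} (hab : s(a, b) ∈ E) (hsep : Separates g a b)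
    (i : Fin c) : insert (s(a, b), i) g ∈ creditForests c E := by
  rw [mem_creditForests] at *
  refine ⟨fun x hx => ?_, ?_⟩
  · rcases mem_insert.1 hx with rfl | hx
    · exact hab
    · exact hg.1 x hx
  · rw [coe_insert]
    exact hg.2.insert hsep

omit [Fintype V] in
theorem notMem_of_separates {g : Finset (Sym2 V × Fin c)} {a b : V} (hsep : Separates g a b)
    (i : Fin c) : (s(a, b), i) ∉ g := fun h =>
  hsep (Submodule.subset_span ⟨(s(a, b), i), mem_coe.2 h, rfl⟩)

omit [Fintype V] in
/-- A node that meets no edge of `g` is separated from all other nodes. -/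
theorem separates_of_edgeDeg_eq_zero {g : Finset (Sym2 V × Fin c)} {v a : V} (hva : v ≠ a)
    (hg : ∀ x ∈ g, v ∉ x.1) : Separates g v a := by
  intro h
  -- The coordinate at `v` vanishes on all edges of `g` but not on the edge from `v` to `a`.
  have hle : Submodule.span (ZMod 2) ((edgeVec ∘ Prod.fst) '' (g : Set (Sym2 V × Fin c))) ≤
      LinearMap.ker (LinearMap.proj v : (V → ZMod 2) →ₗ[ZMod 2] ZMod 2) := by
    rw [Submodule.span_le]
    rintro _ ⟨⟨e, i⟩, hx, rfl⟩
    have hv := hg _ (mem_coe.1 hx)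
    induction e using Sym2.ind with
    | _ x y =>
      simp only [Sym2.mem_iff, not_or] at hv
      simp [hv.1, hv.2]
  have := hle h
  simp [hva] at this

omit [Fintype V] in
/-- A random forest isolates `v` with probability at most `1 / (1 + c d)`. -/
theorem card_creditForests_isolated_le {E : Finset (Sym2 V)} (hE : ∀ e ∈ E, ¬ e.IsDiag) (v : V) :
    (1 + c * #{e ∈ E | v ∈ e}) * #(creditForests c {e ∈ E | v ∉ e}) ≤ #(creditForests c E) := by
  set F := creditForests c {e ∈ E | v ∉ e} with hF
  set K := {e ∈ E | v ∈ e} ×ˢ (univ : Finset (Fin c)) with hK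
  have hF' : ∀ g ∈ F, ∀ x ∈ g, v ∉ x.1 := fun g hg x hx =>
    (mem_filter.1 ((mem_creditForests.1 hg).1 x hx)).2
  -- Each forest avoiding `v` extends by any edge copy at `v` to a forest with `v` as a leaf; the
  -- edge and the forest can be read off from the result.
  have hcard : #((K ×ˢ F).image fun z => insert z.1 z.2) = c * #{e ∈ E | v ∈ e} * #F := by
    rw [card_image_of_injOn, card_product, hK, card_product, card_univ, Fintype.card_fin, mul_comm c]
    rintro ⟨x, g⟩ hz ⟨x', g'⟩ hz' h
    simp only [coe_product, Set.mem_prod, mem_coe] at hz hz'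
    have hx := (mem_filter.1 (mem_product.1 hz.1).1).2
    have hx' := (mem_filter.1 (mem_product.1 hz'.1).1).2
    have hfil : ∀ x : Sym2 V × Fin c, v ∈ x.1 → ∀ g ∈ F,
        (insert x g).filter (fun y => v ∈ y.1) = {x} ∧
          (insert x g).filter (fun y => v ∉ y.1) = g := by
      intro x hx g hg
      rw [filter_insert, filter_insert, if_pos hx, if_neg (not_not.2 hx),
        filter_false_of_mem (hF' g hg), filter_true_of_mem (hF' g hg)]
      exact ⟨rfl, rfl⟩
    have h1 := hfil x hx g hz.2
    have h2 := hfil x' hx' g' hz'.2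
    simp only at h
    rw [h] at h1
    rw [Prod.mk.injEq]
    exact ⟨singleton_injective (h1.1.symm.trans h2.1), h1.2.symm.trans h2.2⟩
  have hdisj : Disjoint F ((K ×ˢ F).image fun z => insert z.1 z.2) := by
    rw [disjoint_left]
    intro f hf hf'
    obtain ⟨⟨x, g⟩, hz, rfl⟩ := mem_image.1 hf'
    exact hF' _ hf x (mem_insert_self x g)
      (mem_filter.1 (mem_product.1 (mem_product.1 hz).1).1).2
  rw [add_mul, one_mul, ← hcard, ← card_union_of_disjoint hdisj]
  refine card_le_card (union_subset (creditForests_mono (filter_subset _ _)) ?_)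
  intro f hf
  obtain ⟨⟨⟨e, i⟩, g⟩, hz, rfl⟩ := mem_image.1 hf
  have he := mem_filter.1 (mem_product.1 (mem_product.1 hz).1).1
  have hg := (mem_product.1 hz).2
  obtain ⟨a, ha⟩ := Sym2.mem_iff_exists.1 he.2
  simp only at ha he
  subst ha
  refine insert_mem_creditForests (creditForests_mono (filter_subset _ _) hg) he.1
    (separates_of_edgeDeg_eq_zero ?_ (hF' g hg)) i
  rintro rfl
  exact hE _ he.1 (by simp)

open Classical in
/-- Forests in which `v` has degree at most two. -/
theorem card_edgeDeg_le_two {E : Finset (Sym2 V)} (v : V) :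
    #{f ∈ creditForests c E | edgeDeg f v ≤ 2} ≤
      (1 + c * #{e ∈ E | v ∈ e}) * #(creditForests c {e ∈ E | v ∉ e}) +
      c ^ 2 * ∑ g ∈ creditForests c {e ∈ E | v ∉ e},
        #{z : V × V | s(v, z.1) ∈ E ∧ s(v, z.2) ∈ E ∧ Separates g z.1 z.2} := by
  set F := creditForests c {e ∈ E | v ∉ e} with hF
  set K := {e ∈ E | v ∈ e} ×ˢ (univ : Finset (Fin c)) with hK
  set Q : Finset ((_ : Finset (Sym2 V × Fin c)) × (V × V)) := F.sigma fun g =>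
    {z : V × V | s(v, z.1) ∈ E ∧ s(v, z.2) ∈ E ∧ Separates g z.1 z.2} with hQ
  -- Removing the zero, one or two edges at `v` leaves a forest avoiding `v`. In the last case it
  -- must separate the two neighbours, as otherwise the two edges would close a cycle.
  have hsub : {f ∈ creditForests c E | edgeDeg f v ≤ 2} ⊆
      F ∪ (K ×ˢ F).image (fun z => insert z.1 z.2) ∪
        (Q ×ˢ (univ : Finset (Fin c × Fin c))).image fun y =>
          insert (s(v, y.1.2.1), y.2.1) (insert (s(v, y.1.2.2), y.2.2) y.1.1) := by
    intro f hf
    obtain ⟨hf, hdeg⟩ := mem_filter.1 hf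
    have hfE := (mem_creditForests.1 hf).1
    set g := {x ∈ f | v ∉ x.1} with hg
    have hgF : g ∈ F := creditForests_of_subset hf (filter_subset _ _) fun x hx =>
      mem_filter.2 ⟨hfE x (mem_filter.1 hx).1, (mem_filter.1 hx).2⟩
    have hunion : {x ∈ f | v ∈ x.1} ∪ g = f := filter_union_filter_not_eq _ _
    have hmem : ∀ x, x ∈ {x ∈ f | v ∈ x.1} → x.1 ∈ E ∧ v ∈ x.1 := fun x hx =>
      ⟨hfE x (mem_filter.1 hx).1, (mem_filter.1 hx).2⟩
    rw [mem_union, mem_union]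
    unfold edgeDeg at hdeg
    interval_cases hd : #{x ∈ f | v ∈ x.1}
    · rw [card_eq_zero] at hd
      rw [hd, empty_union] at hunion
      exact Or.inl (Or.inl (hunion ▸ hgF))
    · obtain ⟨x, hx⟩ := card_eq_one.1 hd
      rw [hx] at hunion hmem
      have hxm := hmem x (mem_singleton_self x)
      refine Or.inl (Or.inr (mem_image.2 ⟨(x, g), mem_product.2 ⟨?_, hgF⟩, ?_⟩))
      · exact mem_product.2 ⟨mem_filter.2 hxm, mem_univ _⟩
      · rw [← hunion]; rfl
    · obtain ⟨x, y, hxy, hx⟩ := card_eq_two.1 hd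
      rw [hx] at hunion hmem
      obtain ⟨hxE, hxv⟩ := hmem x (by simp)
      obtain ⟨hyE, hyv⟩ := hmem y (by simp)
      obtain ⟨ex, i⟩ := x
      obtain ⟨ey, j⟩ := y
      obtain ⟨a, rfl⟩ := Sym2.mem_iff_exists.1 hxv
      obtain ⟨b, rfl⟩ := Sym2.mem_iff_exists.1 hyv
      have hins : insert (s(v, a), i) (insert (s(v, b), j) g) = f := by
        rw [← hunion]
        ext z
        simp only [mem_insert, mem_union, mem_singleton, or_assoc]
      refine Or.inr (mem_image.2 ⟨(⟨g, (a, b)⟩, (i, j)), mem_product.2 ⟨?_, mem_univ _⟩, hins⟩)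
      refine mem_sigma.2 ⟨hgF, mem_filter.2 ⟨mem_univ _, hxE, hyE, ?_⟩⟩
      intro hsp
      have hind := (mem_creditForests.1 hf).2
      have hnot : (s(v, a), i) ∉ insert (s(v, b), j) g := by
        rw [mem_insert, not_or]
        exact ⟨hxy, fun h => (mem_filter.1 h).2 hxv⟩
      rw [← hins, coe_insert, linearIndepOn_insert (by rwa [mem_coe])] at hind
      refine hind.2 ?_
      have h1 : edgeVec s(v, b) ∈ Submodule.span (ZMod 2) ((edgeVec ∘ Prod.fst) ''
          ((insert (s(v, b), j) g : Finset (Sym2 V × Fin c)) : Set (Sym2 V × Fin c))) :=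
        Submodule.subset_span ⟨(s(v, b), j), by simp, rfl⟩
      have h2 := Submodule.span_mono (Set.image_mono (f := edgeVec ∘ Prod.fst)
        (coe_subset.2 (subset_insert (s(v, b), j) g))) hsp
      change edgeVec s(a, b) ∈ _ at h2
      rw [show s(a, b) = s(b, a) from Sym2.eq_swap] at h2
      have h3 := add_mem h1 h2
      rwa [edgeVec_add] at h3
  refine (card_le_card hsub).trans ((card_union_le _ _).trans ?_)
  refine add_le_add ((card_union_le _ _).trans ?_) (card_image_le.trans ?_)
  · rw [add_mul, one_mul]
    refine Nat.add_le_add_left (card_image_le.trans ?_) _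
    rw [card_product, hK, card_product, card_univ, Fintype.card_fin, mul_comm c]
  · rw [card_product, hQ, card_sigma, card_univ, Fintype.card_prod, Fintype.card_fin, mul_comm, sq]

omit [DecidableEq V] in
theorem card_mk_eq_le_two (e : Sym2 V) [DecidableEq V] : #{z : V × V | s(z.1, z.2) = e} ≤ 2 := by
  induction e using Sym2.ind with
  | _ x y =>
    refine (card_le_card (t := {(x, y), (y, x)}) fun z hz => ?_).trans card_le_two
    have := (mem_filter.1 hz).2
    rw [Sym2.eq_iff] at this
    rw [mem_insert, mem_singleton]
    rcases this with h | h
    · exact Or.inl (Prod.ext h.1 h.2)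
    · exact Or.inr (Prod.ext h.1 h.2)

/-- In a forest at least a third of the nodes have degree at most two. -/
theorem card_le_three_mul_card_edgeDeg_le_two {E : Finset (Sym2 V)} {f : Finset (Sym2 V × Fin c)}
    (hf : f ∈ creditForests c E) : Fintype.card V ≤ 3 * #{v | edgeDeg f v ≤ 2} := by
  have hsum : ∑ v, edgeDeg f v ≤ 2 * #f := by
    simp only [edgeDeg, card_filter]
    rw [sum_comm, mul_comm, ← smul_eq_mul, ← sum_const]
    refine sum_le_sum fun x _ => ?_
    rw [← card_filter]
    obtain ⟨e, i⟩ := x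
    induction e using Sym2.ind with
    | _ x y =>
      refine (card_le_card (t := {x, y}) fun z hz => ?_).trans card_le_two
      simpa using hz
  -- Nodes of degree at least three use up the degree sum, which is at most twice the number of
  -- nodes.
  have h2 : 3 * #{v | ¬ edgeDeg f v ≤ 2} ≤ ∑ v, edgeDeg f v := by
    rw [mul_comm, ← smul_eq_mul, ← sum_const]
    refine (sum_le_sum fun v hv => ?_).trans (sum_le_sum_of_subset (filter_subset _ _))
    have := (mem_filter.1 hv).2
    omega
  have h3 := card_filter_add_card_filter_not (s := (univ : Finset V)) fun v => edgeDeg f v ≤ 2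
  have h4 := card_le_of_mem_creditForests hf
  rw [card_univ] at h3
  omega

open Classical in
/-- Counting the ways to add an edge between two components of a forest. -/
theorem sum_card_crossing_le (E : Finset (Sym2 V)) :
    c * ∑ g ∈ creditForests c E, #{z : V × V | s(z.1, z.2) ∈ E ∧ Separates g z.1 z.2} ≤
      2 * Fintype.card V * #(creditForests c E) := by
  set F := creditForests c E with hF
  have hleft : #((F.sigma fun g =>
      {z : V × V | s(z.1, z.2) ∈ E ∧ Separates g z.1 z.2}) ×ˢ (univ : Finset (Fin c))) =
      c * ∑ g ∈ F, #{z : V × V | s(z.1, z.2) ∈ E ∧ Separates g z.1 z.2} := by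
    rw [card_product, card_sigma, card_univ, Fintype.card_fin, mul_comm]
  have hright : ∀ g ∈ F, #{y : (V × V) × Fin c | (s(y.1.1, y.1.2), y.2) ∈ g} ≤
      2 * Fintype.card V := by
    intro g hg
    refine le_trans (card_le_mul_card_image_of_maps_to (t := g)
      (f := fun y : (V × V) × Fin c => (s(y.1.1, y.1.2), y.2)) (n := 2)
      (fun y hy => (mem_filter.1 hy).2) fun x _ => ?_)
      (Nat.mul_le_mul_left 2 (card_le_of_mem_creditForests hg))
    rw [filter_filter]
    refine le_trans ?_ (card_mk_eq_le_two x.1)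
    refine card_le_card_of_injOn Prod.fst (fun y hy => ?_) fun y hy y' hy' h => ?_
    · have := (mem_filter.1 hy).2.2
      exact mem_filter.2 ⟨mem_univ _, congrArg Prod.fst this⟩
    · have h1 := (mem_filter.1 (mem_coe.1 hy)).2.2
      have h2 := (mem_filter.1 (mem_coe.1 hy')).2.2
      exact Prod.ext h ((Prod.mk.inj (h1.trans h2.symm)).2)
  rw [← hleft]
  -- Adding the crossing edge yields a forest with one marked, ordered edge, which determines the
  -- original data. A forest has at most `Fintype.card V` edges, each with at most two orderings.
  refine (card_le_card_of_injOn (t := F.sigma fun g =>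
    {y : (V × V) × Fin c | (s(y.1.1, y.1.2), y.2) ∈ g})
    (fun y => ⟨insert (s(y.1.2.1, y.1.2.2), y.2) y.1.1, (y.1.2, y.2)⟩) ?_ ?_).trans ?_
  · rintro ⟨⟨g, z⟩, i⟩ hy
    obtain ⟨hg, hz⟩ := mem_sigma.1 (mem_product.1 hy).1
    obtain ⟨-, hzE, hsep⟩ := mem_filter.1 hz
    exact mem_sigma.2 ⟨insert_mem_creditForests hg hzE hsep i,
      mem_filter.2 ⟨mem_univ _, mem_insert_self _ _⟩⟩
  · rintro ⟨⟨g, z⟩, i⟩ hy ⟨⟨g', z'⟩, i'⟩ hy' h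
    obtain ⟨-, hz⟩ := mem_sigma.1 (mem_product.1 (mem_coe.1 hy)).1
    obtain ⟨-, -, hsep⟩ := mem_filter.1 hz
    obtain ⟨-, hz'⟩ := mem_sigma.1 (mem_product.1 (mem_coe.1 hy')).1
    obtain ⟨-, -, hsep'⟩ := mem_filter.1 hz'
    simp only [Sigma.mk.injEq, heq_eq_eq, Prod.mk.injEq] at h
    obtain ⟨h1, h2, h3⟩ := h
    subst h2 h3
    have h4 := congrArg (fun s => s.erase (s(z.1, z.2), i)) h1
    simp only [erase_insert (notMem_of_separates hsep i),
      erase_insert (notMem_of_separates hsep' i)] at h4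
    subst h4
    rfl
  · rw [card_sigma, mul_comm, ← smul_eq_mul, ← sum_const]
    exact sum_le_sum hright

/-- The set of all unordered pairs between two sets of nodes. -/
def cutPairs (S T : Finset V) : Finset (Sym2 V) := (S ×ˢ T).image fun z => s(z.1, z.2)

omit [Fintype V] in
theorem card_cutPairs {S T : Finset V} (h : Disjoint S T) : #(cutPairs S T) = #S * #T := by
  rw [cutPairs, card_image_of_injOn, card_product]
  rintro ⟨x, y⟩ hz ⟨x', y'⟩ hz' he
  simp only [coe_product, Set.mem_prod, mem_coe] at hz hz'
  rcases Sym2.eq_iff.1 he with ⟨h1, h2⟩ | ⟨h1, -⟩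
  · exact Prod.ext h1 h2
  · simp only at h1
    exact absurd hz'.2 (disjoint_left.1 h (h1 ▸ hz.1))

omit [Fintype V] in
theorem not_isDiag_of_mem_cutPairs {S T : Finset V} (h : Disjoint S T) {e : Sym2 V}
    (he : e ∈ cutPairs S T) : ¬ e.IsDiag := by
  obtain ⟨⟨x, y⟩, hxy, rfl⟩ := mem_image.1 he
  obtain ⟨hx, hy⟩ := mem_product.1 hxy
  rw [Sym2.mk_isDiag_iff]
  intro hxy'
  simp only at hxy' hx hy
  exact disjoint_left.1 h hx (hxy' ▸ hy)

open Classical in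
/-- In an expander a forest has many crossing edges relative to the pairs that it separates. -/
theorem card_separated_le {E : Finset (Sym2 V)} {v : V} {κ : ℝ} (hκ : 0 ≤ κ)
    (hexp : ∀ S ⊆ univ.erase v, κ * (#S * #(univ.erase v \ S)) ≤
      #(E ∩ cutPairs S (univ.erase v \ S)))
    (g : Finset (Sym2 V × Fin c)) :
    κ * #{z : V × V | z.1 ≠ v ∧ z.2 ≠ v ∧ Separates g z.1 z.2} ≤
      #{z : V × V | s(z.1, z.2) ∈ {e ∈ E | v ∉ e} ∧ Separates g z.1 z.2} := by
  set U := univ.erase v with hU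
  -- `C a` is the component of `a` among the nodes other than `v`. Both counts are split by the
  -- component of the first node, and expansion is applied to each component against its complement.
  set C : V → Finset V := fun a => {x ∈ U | ¬ Separates g a x} with hC
  have hCeq : ∀ a ∈ U, ∀ x ∈ U, C x = C a ↔ ¬ Separates g a x := by
    intro a ha x hx
    constructor
    · intro h
      have : x ∈ C x := mem_filter.2 ⟨hx, not_separates_self g x⟩
      rw [h] at this
      exact (mem_filter.1 this).2
    · intro h
      refine filter_congr fun y _ => not_congr ⟨fun h1 => ?_, fun h1 => ?_⟩
      · by_contra h2
        exact not_separates_trans (fun h3 => h h3.symm) h2 h1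
      · by_contra h2
        exact not_separates_trans h h2 h1
  have hmapL : ∀ z ∈ ({z : V × V | z.1 ≠ v ∧ z.2 ≠ v ∧ Separates g z.1 z.2} : Finset (V × V)),
      C z.1 ∈ U.image C := by
    intro z hz
    exact mem_image_of_mem _ (mem_erase.2 ⟨(mem_filter.1 hz).2.1, mem_univ _⟩)
  have hmapR : ∀ z ∈ ({z : V × V | s(z.1, z.2) ∈ {e ∈ E | v ∉ e} ∧ Separates g z.1 z.2} :
      Finset (V × V)), C z.1 ∈ U.image C := by
    intro z hz
    have := (mem_filter.1 (mem_filter.1 hz).2.1).2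
    rw [Sym2.mem_iff, not_or] at this
    exact mem_image_of_mem _ (mem_erase.2 ⟨Ne.symm this.1, mem_univ _⟩)
  rw [card_eq_sum_card_fiberwise hmapL, card_eq_sum_card_fiberwise hmapR]
  push_cast
  rw [mul_sum]
  refine sum_le_sum fun S hS => ?_
  obtain ⟨a, ha, rfl⟩ := mem_image.1 hS
  have hsub : C a ⊆ U := filter_subset _ _
  refine le_trans ?_ ((hexp (C a) hsub).trans ?_)
  · refine mul_le_mul_of_nonneg_left ?_ hκ
    rw [← Nat.cast_mul, ← card_product, Nat.cast_le]
    refine card_le_card fun z hz => ?_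
    obtain ⟨hz1, hz2⟩ := mem_filter.1 hz
    obtain ⟨-, hz3, hz4, hz5⟩ := mem_filter.1 hz1
    have hz1U : z.1 ∈ U := mem_erase.2 ⟨hz3, mem_univ _⟩
    have hz2U : z.2 ∈ U := mem_erase.2 ⟨hz4, mem_univ _⟩
    have h1 := (hCeq a ha z.1 hz1U).1 hz2
    refine mem_product.2 ⟨mem_filter.2 ⟨hz1U, h1⟩, mem_sdiff.2 ⟨hz2U, fun h => ?_⟩⟩
    exact not_separates_trans (fun h3 => h1 h3.symm) (mem_filter.1 h).2 hz5
  · rw [Nat.cast_le]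
    refine (card_le_card (t := image (fun z : V × V => s(z.1, z.2)) _) ?_).trans card_image_le
    intro e he
    obtain ⟨heE, hcut⟩ := mem_inter.1 he
    obtain ⟨⟨x, y⟩, hxy, rfl⟩ := mem_image.1 hcut
    obtain ⟨hx, hy⟩ := mem_product.1 hxy
    obtain ⟨hxU, hax⟩ := mem_filter.1 hx
    obtain ⟨hyU, hay⟩ := mem_sdiff.1 hy
    refine mem_image.2 ⟨(x, y), mem_filter.2 ⟨mem_filter.2 ⟨mem_univ _,
      mem_filter.2 ⟨heE, ?_⟩, ?_⟩, (hCeq a ha x hxU).2 hax⟩, rfl⟩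
    · rw [Sym2.mem_iff, not_or]
      exact ⟨(ne_of_mem_erase hxU).symm, (ne_of_mem_erase hyU).symm⟩
    · by_contra h
      exact hay (mem_filter.2 ⟨hyU, not_separates_trans hax h⟩)

-- Permuting coordinates is an injective linear map that carries edge vectors to edge vectors, so
-- forests go to forests.
omit [Fintype V] in
theorem card_relabel_le (E : Finset (Sym2 V)) (v : V) (σ : Equiv.Perm V) (q : ℕ → Prop)
    [DecidablePred q] :
    #{f ∈ creditForests c E | q (edgeDeg f v)} ≤
      #{f ∈ creditForests c (E.image (Sym2.map σ)) | q (edgeDeg f (σ v))} := by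
  have hΦ : Function.Injective (Prod.map (Sym2.map σ) id : Sym2 V × Fin c → Sym2 V × Fin c) :=
    (Sym2.map.injective σ.injective).prodMap Function.injective_id
  refine card_le_card_of_injOn (fun f => f.image (Prod.map (Sym2.map σ) id)) ?_
    (image_injective hΦ).injOn
  intro f hf
  obtain ⟨hf, hq⟩ := mem_filter.1 hf
  rw [mem_creditForests] at hf
  refine mem_filter.2 ⟨mem_creditForests.2 ⟨fun x hx => ?_, ?_⟩, ?_⟩
  · obtain ⟨y, hy, rfl⟩ := mem_image.1 hx
    exact mem_image_of_mem _ (hf.1 y hy)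
  · rw [coe_image]
    refine LinearIndepOn.image_of_comp _ _ ?_
    have hcomp : (edgeVec ∘ Prod.fst) ∘ (Prod.map (Sym2.map σ) id : Sym2 V × Fin c → _) =
        (LinearMap.funLeft (ZMod 2) (ZMod 2) σ.symm) ∘ edgeVec ∘ Prod.fst := by
      funext ⟨e, i⟩
      induction e using Sym2.ind with
      | _ x y =>
        funext u
        simp [LinearMap.funLeft_apply, Pi.single_apply, Equiv.symm_apply_eq]
    rw [hcomp]
    refine hf.2.map_injOn _ (Function.Injective.injOn ?_)
    exact LinearMap.funLeft_injective_of_surjective _ _ _ σ.symm.surjective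
  · have : edgeDeg (f.image (Prod.map (Sym2.map σ) id)) (σ v) = edgeDeg f v := by
      unfold edgeDeg
      rw [filter_image, card_image_of_injective _ hΦ]
      congr 1
      refine filter_congr fun x _ => ?_
      simp [Sym2.mem_map]
    rwa [this]

omit [Fintype V] in
theorem card_relabel (E : Finset (Sym2 V)) (v : V) (σ : Equiv.Perm V) (q : ℕ → Prop)
    [DecidablePred q] :
    #{f ∈ creditForests c (E.image (Sym2.map σ)) | q (edgeDeg f (σ v))} =
      #{f ∈ creditForests c E | q (edgeDeg f v)} := by
  refine le_antisymm ?_ (card_relabel_le E v σ q)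
  refine (card_relabel_le (E.image (Sym2.map σ)) (σ v) σ.symm q).trans (le_of_eq ?_)
  rw [image_image, ← Sym2.map_comp, Equiv.symm_comp_self, Sym2.map_id, image_id,
    Equiv.symm_apply_apply]

end ForestCounting

/-! ### Expectations over random subsets and a Chernoff bound. -/

section BernoulliExpectation

variable {α : Type*} [DecidableEq α] {p : ℝ} {D : Finset α}

/-- The expectation of `φ` on the random subset of `D` that contains each element independently
with probability `p`. -/
noncomputable def bernoulliExp (p : ℝ) (D : Finset α) (φ : Finset α → ℝ) : ℝ :=
  ∑ E ∈ D.powerset, p ^ #E * (1 - p) ^ #(D \ E) * φ E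

theorem bernoulliExp_mono (hp0 : 0 ≤ p) (hp1 : p ≤ 1) {φ ψ : Finset α → ℝ}
    (h : ∀ E ⊆ D, φ E ≤ ψ E) : bernoulliExp p D φ ≤ bernoulliExp p D ψ :=
  sum_le_sum fun E hE => mul_le_mul_of_nonneg_left (h E (mem_powerset.1 hE))
    (mul_nonneg (pow_nonneg hp0 _) (pow_nonneg (sub_nonneg.2 hp1) _))

theorem bernoulliExp_congr {φ ψ : Finset α → ℝ} (h : ∀ E ⊆ D, φ E = ψ E) :
    bernoulliExp p D φ = bernoulliExp p D ψ :=
  sum_congr rfl fun E hE => by rw [h E (mem_powerset.1 hE)]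

theorem bernoulliExp_add (φ ψ : Finset α → ℝ) :
    bernoulliExp p D (fun E => φ E + ψ E) = bernoulliExp p D φ + bernoulliExp p D ψ := by
  simp only [bernoulliExp, mul_add, sum_add_distrib]

theorem bernoulliExp_mul_left (a : ℝ) (φ : Finset α → ℝ) :
    bernoulliExp p D (fun E => a * φ E) = a * bernoulliExp p D φ := by
  simp only [bernoulliExp, mul_sum]
  exact sum_congr rfl fun E _ => by ring

theorem bernoulliExp_sum {β : Type*} (s : Finset β) (φ : β → Finset α → ℝ) :
    bernoulliExp p D (fun E => ∑ b ∈ s, φ b E) = ∑ b ∈ s, bernoulliExp p D (φ b) := by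
  simp only [bernoulliExp, mul_sum]
  exact sum_comm

/-- The generating function of a binomial variable, obtained by expanding a product over `D` into a
sum over subsets. -/
theorem bernoulliExp_pow_card_inter (r : ℝ) {T : Finset α} (hT : T ⊆ D) :
    bernoulliExp p D (fun E => r ^ #(E ∩ T)) = (1 - p + p * r) ^ #T := by
  have h1 := prod_add (fun e => p * if e ∈ T then r else 1) (fun _ => 1 - p) D
  have h2 : ∏ e ∈ D, ((p * if e ∈ T then r else 1) + (1 - p)) = (1 - p + p * r) ^ #T := by
    rw [← prod_subset hT, prod_congr rfl fun e he => by rw [if_pos he], prod_const]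
    · ring
    · intro e _ he
      rw [if_neg he]
      ring
  rw [← h2, h1]
  refine sum_congr rfl fun E _ => ?_
  rw [prod_mul_distrib, prod_const, prod_const, prod_ite, prod_const_one, mul_one, prod_const,
    filter_mem_eq_inter]
  ring

theorem bernoulliExp_const (a : ℝ) : bernoulliExp p D (fun _ => a) = a := by
  have h := bernoulliExp_pow_card_inter (p := p) 1 (empty_subset D)
  have h2 := bernoulliExp_mul_left (p := p) (D := D) a fun E => 1 ^ #(E ∩ ∅)
  rw [h] at h2
  simpa using h2

/-- The presence of an element is independent of all that does not depend on it. -/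
theorem bernoulliExp_mem {x : α} (hx : x ∈ D) {ψ : Finset α → ℝ}
    (hψ : ∀ E, ψ (insert x E) = ψ E) :
    bernoulliExp p D (fun E => if x ∈ E then ψ E else 0) = p * bernoulliExp p D ψ := by
  obtain ⟨D', hxD', rfl⟩ : ∃ D', x ∉ D' ∧ insert x D' = D :=
    ⟨D.erase x, notMem_erase x D, insert_erase hx⟩
  simp only [bernoulliExp]
  rw [sum_powerset_insert hxD', sum_powerset_insert hxD', ← sum_add_distrib, ← sum_add_distrib,
    mul_sum]
  refine sum_congr rfl fun E hE => ?_
  have hxE : x ∉ E := fun h => hxD' (mem_powerset.1 hE h)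
  rw [if_neg hxE, if_pos (mem_insert_self x E), hψ, card_insert_of_notMem hxE,
    insert_sdiff_insert, sdiff_insert_of_notMem hxD', insert_sdiff_of_notMem _ hxE,
    card_insert_of_notMem (by simp [hxD'])]
  ring

theorem bernoulliExp_image (σ : Equiv.Perm α) (hσ : D.image σ = D) (φ : Finset α → ℝ) :
    bernoulliExp p D (fun E => φ (E.image σ)) = bernoulliExp p D φ := by
  unfold bernoulliExp
  refine sum_bij' (fun E _ => E.image σ) (fun E _ => E.image σ.symm) ?_ ?_ ?_ ?_ ?_
  · intro E hE
    rw [mem_powerset] at *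
    exact hσ ▸ image_subset_image hE
  · intro E hE
    rw [mem_powerset] at *
    have := image_subset_image (f := σ.symm) hE
    rwa [← hσ, image_image, Equiv.symm_comp_self, image_id] at this
  · intro E _
    rw [image_image, Equiv.symm_comp_self, image_id]
  · intro E _
    rw [image_image, Equiv.self_comp_symm, image_id]
  · intro E _
    have h1 : #(E.image σ) = #E := card_image_of_injective _ σ.injective
    have h2 : #(D \ E.image σ) = #(D \ E) := by
      conv_lhs => rw [← hσ, ← image_sdiff _ _ σ.injective]
      exact card_image_of_injective _ σ.injective
    rw [h1, h2]

/-- A Chernoff bound for the lower tail. -/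
theorem bernoulliExp_card_inter_lt (hp0 : 0 ≤ p) (hp1 : p ≤ 1) {T : Finset α} (hT : T ⊆ D) :
    bernoulliExp p D (fun E => if (#(E ∩ T) : ℝ) < p / 16 * #T then 1 else 0) ≤
      Real.exp (-(5 / 8 * (p * #T))) := by
  have hr : Real.exp (-2) ≤ 1 / 4 := by
    have h1 : (2 : ℝ) ≤ Real.exp 1 := by
      have := Real.add_one_le_exp (1 : ℝ)
      linarith
    have h2 : Real.exp 2 = Real.exp 1 * Real.exp 1 := by rw [← Real.exp_add]; norm_num
    rw [Real.exp_neg, one_div]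
    refine inv_anti₀ (by norm_num) ?_
    rw [h2]
    nlinarith
  -- Exponential Markov inequality with parameter `2`, which gives `2 * p / 16 = p / 8`. As `exp
  -- (-2) ≤ 1 / 4`, each factor is at most `1 - 3 * p / 4`, and `3 / 4 - 1 / 8 = 5 / 8`.
  calc bernoulliExp p D (fun E => if (#(E ∩ T) : ℝ) < p / 16 * #T then 1 else 0)
      ≤ bernoulliExp p D (fun E => Real.exp (p / 8 * #T) * Real.exp (-2) ^ #(E ∩ T)) := by
        refine bernoulliExp_mono hp0 hp1 fun E _ => ?_
        rw [← Real.exp_nat_mul, ← Real.exp_add]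
        split_ifs with h
        · rw [Real.one_le_exp_iff]
          linarith
        · exact (Real.exp_pos _).le
    _ = Real.exp (p / 8 * #T) * (1 - p + p * Real.exp (-2)) ^ #T := by
        rw [bernoulliExp_mul_left, bernoulliExp_pow_card_inter _ hT]
    _ ≤ Real.exp (p / 8 * #T) * Real.exp (-(3 / 4 * p)) ^ #T := by
        have h0 : 0 ≤ 1 - p + p * Real.exp (-2) :=
          add_nonneg (sub_nonneg.2 hp1) (mul_nonneg hp0 (Real.exp_pos _).le)
        have h1 : 1 - p + p * Real.exp (-2) ≤ Real.exp (-(3 / 4 * p)) := by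
          have := Real.add_one_le_exp (-(3 / 4 * p))
          nlinarith
        gcongr
    _ = Real.exp (-(5 / 8 * (p * #T))) := by
        rw [← Real.exp_nat_mul, ← Real.exp_add]
        congr 1
        ring

end BernoulliExpectation

/-! ### The binomial random graph as a random edge set. -/

section RandomGraph

open MeasureTheory

variable {V : Type*} [Fintype V] [DecidableEq V]

/-- The edges of the complete graph. -/
def allEdges (V : Type*) [Fintype V] [DecidableEq V] : Finset (Sym2 V) :=
  {e : Sym2 V | ¬ e.IsDiag}

theorem mem_allEdges {e : Sym2 V} : e ∈ allEdges V ↔ ¬ e.IsDiag := by simp [allEdges]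

open Classical in
/-- The finite edge set of a graph. -/
noncomputable def edgesOf (G : SimpleGraph V) : Finset (Sym2 V) := {e : Sym2 V | e ∈ G.edgeSet}

omit [DecidableEq V] in
theorem mem_edgesOf {G : SimpleGraph V} {e : Sym2 V} : e ∈ edgesOf G ↔ e ∈ G.edgeSet := by
  simp [edgesOf]

theorem integral_binomialRandom (p : unitInterval) (φ : Finset (Sym2 V) → ℝ) :
    ∫ G, φ (edgesOf G) ∂(SimpleGraph.binomialRandom V p) =
      bernoulliExp (p : ℝ) (allEdges V) φ := by
  classical
  have : MeasurableSingletonClass (SimpleGraph V) := ⟨fun G => by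
    rw [← SimpleGraph.measurableEmbedding_edgeSet.measurableSet_image, Set.image_singleton]
    exact measurableSet_singleton _⟩
  rw [integral_fintype Integrable.of_finite]
  unfold bernoulliExp
  refine sum_bij' (fun G _ => edgesOf G) (fun E _ => SimpleGraph.fromEdgeSet (E : Set (Sym2 V)))
    ?_ ?_ ?_ ?_ ?_
  · intro G _
    rw [mem_powerset]
    intro e he
    exact mem_allEdges.2 (G.not_isDiag_of_mem_edgeSet (mem_edgesOf.1 he))
  · exact fun _ _ => mem_univ _
  · intro G _
    have : ((edgesOf G : Finset (Sym2 V)) : Set (Sym2 V)) = G.edgeSet := by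
      ext e
      rw [mem_coe, mem_edgesOf]
    simp only [this, SimpleGraph.fromEdgeSet_edgeSet]
  · intro E hE
    ext e
    rw [mem_edgesOf, SimpleGraph.edgeSet_fromEdgeSet]
    have := fun h => mem_allEdges.1 (mem_powerset.1 hE h : e ∈ allEdges V)
    simpa using this
  · intro G _
    have hset : ((edgesOf G : Finset (Sym2 V)) : Set (Sym2 V)) = G.edgeSet := by
      ext e
      rw [mem_coe, mem_edgesOf]
    have hcard : (#(allEdges V)) = (Nat.card V).choose 2 := by
      rw [Nat.card_eq_fintype_card, ← Sym2.card_subtype_not_diag, Fintype.card_subtype, allEdges]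
    have hsub : edgesOf G ⊆ allEdges V := fun e he =>
      mem_allEdges.2 (G.not_isDiag_of_mem_edgeSet (mem_edgesOf.1 he))
    rw [measureReal_def, SimpleGraph.binomialRandom_singleton, smul_eq_mul, ← hset,
      Set.ncard_coe_finset, card_sdiff_of_subset hsub, hcard]
    simp

end RandomGraph

/-! ### Two-sided estimates for the isolation probability in the random graph. -/

section RandomForest

variable {V : Type*} [Fintype V] [DecidableEq V] {c : ℕ} {p : ℝ}

/-- The probability that `v` is isolated in a random forest. -/
noncomputable def isolationProb (c : ℕ) (v : V) (E : Finset (Sym2 V)) : ℝ :=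
  (#(creditForests c {e ∈ E | v ∉ e}) : ℝ) / #(creditForests c E)

omit [Fintype V] in
theorem isolationProb_nonneg (c : ℕ) (v : V) (E : Finset (Sym2 V)) : 0 ≤ isolationProb c v E := by
  unfold isolationProb
  positivity

omit [Fintype V] in
theorem isolationProb_le_one (c : ℕ) (v : V) (E : Finset (Sym2 V)) : isolationProb c v E ≤ 1 :=
  div_le_one_of_le₀ (Nat.cast_le.2 (card_le_card (creditForests_mono (filter_subset _ _))))
    (Nat.cast_nonneg _)

omit [Fintype V] in
theorem isolationProb_mul_le_one {v : V} {E : Finset (Sym2 V)} (hE : ∀ e ∈ E, ¬ e.IsDiag) :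
    isolationProb c v E * (1 + c * #{e ∈ E | v ∈ e}) ≤ 1 := by
  have hpos : (0 : ℝ) < #(creditForests c E) := Nat.cast_pos.2 (card_creditForests_pos c E)
  have h := card_creditForests_isolated_le (c := c) hE v
  rw [isolationProb, div_mul_eq_mul_div, div_le_one hpos, mul_comm]
  exact_mod_cast h

theorem inter_cutPairs_singleton {v : V} {E : Finset (Sym2 V)} (hE : ∀ e ∈ E, ¬ e.IsDiag) :
    E ∩ cutPairs {v} (univ.erase v) = {e ∈ E | v ∈ e} := by
  ext e
  rw [mem_inter, mem_filter]
  refine and_congr_right fun he => ?_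
  constructor
  · intro h
    obtain ⟨⟨x, y⟩, hxy, rfl⟩ := mem_image.1 h
    rw [mem_product, mem_singleton] at hxy
    simp only at hxy
    simp [hxy.1]
  · intro h
    obtain ⟨a, rfl⟩ := Sym2.mem_iff_exists.1 h
    have := hE _ he
    rw [Sym2.mk_isDiag_iff] at this
    exact mem_image.2 ⟨(v, a), by simp [Ne.symm this], rfl⟩

theorem cutPairs_subset_allEdges {S T : Finset V} (h : Disjoint S T) :
    cutPairs S T ⊆ allEdges V := fun _ he => mem_allEdges.2 (not_isDiag_of_mem_cutPairs h he)

theorem disjoint_singleton_erase (v : V) : Disjoint {v} (univ.erase v) := by simp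

theorem card_cutPairs_singleton (v : V) :
    #(cutPairs {v} (univ.erase v)) = Fintype.card V - 1 := by
  rw [card_cutPairs (disjoint_singleton_erase v), card_singleton, one_mul,
    card_erase_of_mem (mem_univ v), card_univ]

/-- The number of nodes and the density are large enough for the estimates below. -/
theorem large_of_log_lt {n c : ℕ} (hn : 2 ≤ n) (hc : 1 ≤ c) (hp1 : p ≤ 1)
    (hp : 8 * Real.log ((c : ℝ) * n) / n < p) :
    17 ≤ n ∧ 1 ≤ n * p * c ∧ 0 < p ∧ 8 * Real.log n ≤ n * p ∧ 8 * Real.log c ≤ n * p := by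
  have hn0 : (0 : ℝ) < n := by positivity
  have hc1 : (1 : ℝ) ≤ c := by exact_mod_cast hc
  have hn2 : (2 : ℝ) ≤ n := by exact_mod_cast hn
  have hlc : 0 ≤ Real.log c := Real.log_nonneg hc1
  have hln : Real.log 2 ≤ Real.log n := Real.log_le_log (by norm_num) hn2
  have hl2 := Real.log_two_gt_d9
  rw [div_lt_iff₀ hn0, Real.log_mul (by positivity) hn0.ne'] at hp
  have hpn : p * n ≤ n := by nlinarith
  have hp0 : 0 < p := by
    by_contra h
    nlinarith
  -- Bootstrapping: `p ≤ 1` forces `n > 8 * log n`, which raises the bound on `n` from `2` to `6`,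
  -- then to `12`, then to `17`.
  have hpow : ∀ k : ℕ, 2 ^ k ≤ n → 8 * (k * Real.log 2) < n := by
    intro k hk
    have h1 : Real.log ((2 : ℝ) ^ k) ≤ Real.log n :=
      Real.log_le_log (by positivity) (by exact_mod_cast hk)
    rw [Real.log_pow] at h1
    linarith
  have h6 : 6 ≤ n := by
    have h := hpow 1 (by omega)
    have h5 : (5 : ℝ) < n := by push_cast at h; linarith
    exact_mod_cast h5
  have h12 : 12 ≤ n := by
    have h := hpow 2 (by omega)
    have h5 : (11 : ℝ) < n := by push_cast at h; linarith
    exact_mod_cast h5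
  have h17 : 17 ≤ n := by
    have h := hpow 3 (by omega)
    have h5 : (16 : ℝ) < n := by push_cast at h; linarith
    exact_mod_cast h5
  refine ⟨h17, ?_, hp0, by linarith, by linarith⟩
  have h1 : 1 ≤ n * p := by linarith
  nlinarith

/-- The exponent is at least `log c + n * p / 4`: the first term supplies the factor `1 / c`, and
the second supplies `4 / (n * p)` through `exp x ≥ x`. -/
theorem exp_degree_bound {n c : ℕ} (hn : 17 ≤ n) (hc : 1 ≤ c) (hp0 : 0 < p)
    (hp : 8 * Real.log c ≤ n * p) :
    Real.exp (-(5 / 8 * (p * ((n - 1 : ℕ) : ℝ)))) ≤ 4 / (n * p * c) := by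
  have hn0 : (17 : ℝ) ≤ n := by exact_mod_cast hn
  have hc0 : (0 : ℝ) < c := by exact_mod_cast hc
  have hnp : 0 < n * p := by positivity
  rw [Nat.cast_pred (by omega)]
  calc Real.exp (-(5 / 8 * (p * ((n : ℝ) - 1))))
      ≤ Real.exp (-(Real.log c + n * p / 4)) := by
        apply Real.exp_le_exp.2
        nlinarith
    _ = ((c : ℝ) * Real.exp (n * p / 4))⁻¹ := by
        rw [Real.exp_neg, Real.exp_add, Real.exp_log hc0]
    _ ≤ ((c : ℝ) * (n * p / 4))⁻¹ := by
        refine inv_anti₀ (by positivity) (mul_le_mul_of_nonneg_left ?_ hc0.le)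
        have := Real.add_one_le_exp (n * p / 4)
        linarith
    _ = 4 / (n * p * c) := by
        field_simp

/-- The upper bound for the isolation probability in the random graph. -/
theorem bernoulliExp_isolationProb_le {n : ℕ} (hV : Fintype.card V = n) (hn : 17 ≤ n)
    (hc : 1 ≤ c) (hp0 : 0 < p) (hp1 : p ≤ 1) (hp : 8 * Real.log c ≤ n * p) (v : V) :
    bernoulliExp p (allEdges V) (isolationProb c v) ≤ 36 / (n * p * c) := by
  have hn0 : (17 : ℝ) ≤ n := by exact_mod_cast hn
  have hc0 : (0 : ℝ) < c := by exact_mod_cast hc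
  have hcut := cutPairs_subset_allEdges (disjoint_singleton_erase v)
  have hcard : (#(cutPairs {v} (univ.erase v)) : ℝ) = n - 1 := by
    rw [card_cutPairs_singleton, hV, Nat.cast_pred (by omega)]
  -- Unless the degree is atypically small it is at least `p * (n - 1) / 16 ≥ n * p / 32`, which
  -- gives the `32`; the exceptional event adds the remaining `4`.
  have hpt : ∀ E ⊆ allEdges V, isolationProb c v E ≤ 32 / (n * p * c) +
      if (#(E ∩ cutPairs {v} (univ.erase v)) : ℝ) <
        p / 16 * #(cutPairs {v} (univ.erase v)) then 1 else 0 := by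
    intro E hE
    have hE' : ∀ e ∈ E, ¬ e.IsDiag := fun e he => mem_allEdges.1 (hE he)
    split_ifs with h
    · have : 0 ≤ 32 / (n * p * c) := by positivity
      linarith [isolationProb_le_one c v E]
    · rw [inter_cutPairs_singleton hE', hcard, not_lt] at h
      have h1 := isolationProb_mul_le_one (c := c) (v := v) hE'
      have h2 : n * p * c / 32 ≤ 1 + c * (#{e ∈ E | v ∈ e} : ℝ) := by
        have h3 : n * p / 32 ≤ (#{e ∈ E | v ∈ e} : ℝ) := le_trans (by nlinarith) h
        nlinarith
      have h4 := mul_le_mul_of_nonneg_left h2 (isolationProb_nonneg c v E)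
      rw [add_zero, le_div_iff₀ (by positivity)]
      linarith
  refine (bernoulliExp_mono hp0.le hp1 hpt).trans ?_
  rw [bernoulliExp_add, bernoulliExp_const]
  have h1 := bernoulliExp_card_inter_lt hp0.le hp1 hcut
  have h2 := exp_degree_bound hn hc hp0 hp
  rw [card_cutPairs_singleton, hV] at h1
  rw [show (36 : ℝ) / (n * p * c) = 32 / (n * p * c) + 4 / (n * p * c) by ring]
  rw [card_cutPairs_singleton, hV]
  linarith

/-- The graph without the node `v` has no sparse cut. -/
def IsExpander (p : ℝ) (v : V) (E : Finset (Sym2 V)) : Prop :=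
  ∀ S ⊆ univ.erase v, p / 16 * (#S * #(univ.erase v \ S)) ≤
    #(E ∩ cutPairs S (univ.erase v \ S))

/-- The cuts involved never use pairs containing `v`; this makes expansion independent of the edges
at `v`. -/
theorem isExpander_insert {v a : V} (E : Finset (Sym2 V)) :
    IsExpander p v (insert s(v, a) E) ↔ IsExpander p v E := by
  have : ∀ S ⊆ univ.erase v, insert s(v, a) E ∩ cutPairs S (univ.erase v \ S) =
      E ∩ cutPairs S (univ.erase v \ S) := by
    intro S hS
    refine insert_inter_of_notMem fun h => ?_
    obtain ⟨⟨x, y⟩, hxy, he⟩ := mem_image.1 h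
    obtain ⟨hx, hy⟩ := mem_product.1 hxy
    have hx' := ne_of_mem_erase (hS hx)
    have hy' := ne_of_mem_erase (mem_sdiff.1 hy).1
    rcases Sym2.eq_iff.1 he with ⟨h1, -⟩ | ⟨-, h1⟩
    · exact hx' h1
    · exact hy' h1
  unfold IsExpander
  exact forall₂_congr fun S hS => by rw [this S hS]

open Classical in
/-- The random graph is an expander with high probability. -/
theorem bernoulliExp_not_isExpander_le {n : ℕ} (hV : Fintype.card V = n) (hn : 17 ≤ n)
    (hp0 : 0 < p) (hp1 : p ≤ 1) (hp : 8 * Real.log n ≤ n * p) (v : V) :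
    bernoulliExp p (allEdges V) (fun E => if IsExpander p v E then 0 else 1) ≤ 1 / 6 := by
  have hn0 : (17 : ℝ) ≤ n := by exact_mod_cast hn
  set U : Finset V := univ.erase v with hU
  have hUcard : #U = n - 1 := by rw [hU, card_erase_of_mem (mem_univ v), card_univ, hV]
  have hUreal : (#U : ℝ) = n - 1 := by rw [hUcard, Nat.cast_pred (by omega)]
  have hUne : U.Nonempty := card_pos.1 (by omega)
  -- Since `|S| * |U \ S|` is at least half of `|U|` times the smaller part, a cut fails with
  -- probability at most `y` to the size of its smaller part.
  set y : ℝ := Real.exp (-(5 / 16 * (p * #U))) with hy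
  have hy0 : 0 < y := Real.exp_pos _
  have hy1 : y ≤ 1 := Real.exp_le_one_iff.2 (by nlinarith)
  have hyn : y ≤ 1 / (n : ℝ) ^ 2 := by
    have hlog : 0 ≤ Real.log n := Real.log_nonneg (by linarith)
    calc y ≤ Real.exp (-(2 * Real.log n)) := by
          apply Real.exp_le_exp.2
          rw [hUreal]
          nlinarith
      _ = 1 / (n : ℝ) ^ 2 := by
          rw [Real.exp_neg, one_div, two_mul, Real.exp_add, Real.exp_log (by linarith), sq]
  -- The trivial cuts cannot fail. The indicators remove their terms equal to one, so that the sum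
  -- over all cuts is `2 * ((1 + y) ^ #U - 1)`, which is small.
  have hterm : ∀ S ∈ U.powerset, bernoulliExp p (allEdges V) (fun E =>
      if (#(E ∩ cutPairs S (U \ S)) : ℝ) < p / 16 * #(cutPairs S (U \ S)) then 1 else 0) ≤
        (y ^ #S - if S = ∅ then 1 else 0) + (y ^ #(U \ S) - if S = U then 1 else 0) := by
    intro S hS
    have hSU := mem_powerset.1 hS
    by_cases h0 : S = ∅ ∨ S = U
    · have hempty : cutPairs S (U \ S) = ∅ := by
        rcases h0 with rfl | rfl <;> simp [cutPairs]
      rw [hempty]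
      simp only [inter_empty, card_empty, Nat.cast_zero, mul_zero, lt_irrefl, if_false]
      rw [bernoulliExp_const]
      rcases h0 with rfl | rfl
      · rw [if_pos rfl, if_neg hUne.ne_empty.symm, card_empty, pow_zero]
        have := pow_nonneg hy0.le #(U \ ∅)
        linarith
      · rw [if_pos rfl, if_neg hUne.ne_empty, Finset.sdiff_self, card_empty, pow_zero]
        have := pow_nonneg hy0.le #U
        linarith
    · rw [not_or] at h0
      rw [if_neg h0.1, if_neg h0.2, sub_zero, sub_zero]
      refine (bernoulliExp_card_inter_lt hp0.le hp1
        (cutPairs_subset_allEdges disjoint_sdiff)).trans ?_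
      rw [card_cutPairs disjoint_sdiff]
      have hadd : (#(U \ S) : ℝ) + #S = #U := by exact_mod_cast card_sdiff_add_card_eq_card hSU
      push_cast
      have hs0 : (0 : ℝ) ≤ #S := Nat.cast_nonneg _
      have ht0 : (0 : ℝ) ≤ #(U \ S) := Nat.cast_nonneg _
      rcases le_total (#S : ℝ) #(U \ S) with h | h
      · refine le_trans ?_ (le_add_of_nonneg_right (pow_nonneg hy0.le _))
        rw [hy, ← Real.exp_nat_mul]
        apply Real.exp_le_exp.2
        have h2 : (#U : ℝ) * #S ≤ 2 * (#S * #(U \ S)) := by nlinarith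
        have h3 := mul_le_mul_of_nonneg_left h2 hp0.le
        linarith
      · refine le_trans ?_ (le_add_of_nonneg_left (pow_nonneg hy0.le _))
        rw [hy, ← Real.exp_nat_mul]
        apply Real.exp_le_exp.2
        have h2 : (#U : ℝ) * #(U \ S) ≤ 2 * (#S * #(U \ S)) := by nlinarith
        have h3 := mul_le_mul_of_nonneg_left h2 hp0.le
        linarith
  have hsum1 : ∑ S ∈ U.powerset, y ^ #S = (1 + y) ^ #U := by
    have h := Finset.sum_pow_mul_eq_add_pow y 1 U
    simp only [one_pow, mul_one] at h
    rw [h, add_comm]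
  have hsum2 : ∑ S ∈ U.powerset, y ^ #(U \ S) = (1 + y) ^ #U := by
    have h := Finset.sum_pow_mul_eq_add_pow 1 y U
    simp only [one_pow, one_mul] at h
    rw [← h]
    exact sum_congr rfl fun S hS => by rw [card_sdiff_of_subset (mem_powerset.1 hS)]
  have hpow : (1 + y) ^ #U ≤ 1 + 1 / 12 := by
    have h1 : (1 + y) ^ #U ≤ Real.exp (1 / n) := by
      calc (1 + y) ^ #U ≤ Real.exp y ^ #U := by
            have := Real.add_one_le_exp y
            gcongr
            linarith
        _ = Real.exp (#U * y) := by rw [← Real.exp_nat_mul]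
        _ ≤ Real.exp (1 / n) := by
            apply Real.exp_le_exp.2
            calc (#U : ℝ) * y ≤ n * (1 / (n : ℝ) ^ 2) := by
                  rw [hUreal]
                  gcongr
                  linarith
              _ = 1 / n := by field_simp
    have h2 : (1 : ℝ) / n ≤ 1 / 17 := one_div_le_one_div_of_le (by norm_num) hn0
    have h3 : Real.exp (1 / n) ≤ Real.exp (1 / 17) := Real.exp_le_exp.2 h2
    have h4 := Real.exp_bound_div_one_sub_of_interval (x := 1 / 17) (by norm_num) (by norm_num)
    norm_num at h4 ⊢
    linarith
  calc bernoulliExp p (allEdges V) (fun E => if IsExpander p v E then 0 else 1)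
      ≤ bernoulliExp p (allEdges V) (fun E => ∑ S ∈ U.powerset,
          if (#(E ∩ cutPairs S (U \ S)) : ℝ) < p / 16 * #(cutPairs S (U \ S)) then 1 else 0) := by
        refine bernoulliExp_mono hp0.le hp1 fun E _ => ?_
        have hnn : ∀ S ∈ U.powerset, (0 : ℝ) ≤
            if (#(E ∩ cutPairs S (U \ S)) : ℝ) < p / 16 * #(cutPairs S (U \ S)) then 1 else 0 :=
          fun S _ => by split_ifs <;> norm_num
        split_ifs with h
        · exact sum_nonneg hnn
        · unfold IsExpander at h
          push Not at h
          obtain ⟨S, hS, hlt⟩ := h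
          refine le_trans (le_of_eq ?_) (single_le_sum hnn (mem_powerset.2 hS))
          rw [if_pos]
          rw [card_cutPairs disjoint_sdiff]
          exact_mod_cast hlt
    _ = ∑ S ∈ U.powerset, bernoulliExp p (allEdges V) (fun E =>
          if (#(E ∩ cutPairs S (U \ S)) : ℝ) < p / 16 * #(cutPairs S (U \ S)) then 1 else 0) :=
        bernoulliExp_sum _ _
    _ ≤ ∑ S ∈ U.powerset,
          ((y ^ #S - if S = ∅ then 1 else 0) + (y ^ #(U \ S) - if S = U then 1 else 0)) :=
        sum_le_sum hterm
    _ = 2 * ((1 + y) ^ #U - 1) := by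
        rw [sum_add_distrib, sum_sub_distrib, sum_sub_distrib, hsum1, hsum2, sum_ite_eq',
          sum_ite_eq', if_pos (by simp), if_pos (by simp)]
        ring
    _ ≤ 1 / 6 := by linarith

open Classical in
/-- The expected number of pairs of neighbours of `v` that a random forest on the other nodes
separates, on the event that these nodes span an expander. -/
theorem bernoulliExp_separated_le {n : ℕ} (hV : Fintype.card V = n) (hc : 1 ≤ c)
    (hp0 : 0 < p) (hp1 : p ≤ 1) (v : V) :
    bernoulliExp p (allEdges V) (fun E => if IsExpander p v E then
      (∑ g ∈ creditForests c {e ∈ E | v ∉ e},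
        (#{z : V × V | s(v, z.1) ∈ E ∧ s(v, z.2) ∈ E ∧ Separates g z.1 z.2} : ℝ)) /
          #(creditForests c {e ∈ E | v ∉ e}) else 0) ≤ 32 * n * p / c := by
  have hc0 : (0 : ℝ) < c := by exact_mod_cast hc
  set ψ : V × V → Finset (Sym2 V) → ℝ := fun z E => if IsExpander p v E then
    (#{g ∈ creditForests c {e ∈ E | v ∉ e} | z.1 ≠ v ∧ z.2 ≠ v ∧ Separates g z.1 z.2} : ℝ) /
      #(creditForests c {e ∈ E | v ∉ e}) else 0 with hψ
  have hfil : ∀ (a : V) (E : Finset (Sym2 V)),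
      ({e ∈ insert s(v, a) E | v ∉ e}) = {e ∈ E | v ∉ e} := fun a E => by
    rw [filter_insert, if_neg (by simp)]
  have hψins : ∀ (a : V) z E, ψ z (insert s(v, a) E) = ψ z E := by
    intro a z E
    simp only [hψ, isExpander_insert, hfil]
  have hψ0 : ∀ z E, 0 ≤ ψ z E := by
    intro z E
    simp only [hψ]
    split_ifs
    · positivity
    · exact le_rfl
  -- `ψ z` ignores the edges at `v`, so for distinct neighbours each of the two edges contributes an
  -- independent factor `p`. For degenerate pairs `ψ z` vanishes.
  have hterm : ∀ z : V × V, bernoulliExp p (allEdges V)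
      (fun E => if s(v, z.1) ∈ E then if s(v, z.2) ∈ E then ψ z E else 0 else 0) ≤
        p ^ 2 * bernoulliExp p (allEdges V) (ψ z) := by
    intro z
    by_cases hz : z.1 ≠ v ∧ z.2 ≠ v ∧ z.1 ≠ z.2
    · obtain ⟨h1, h2, h12⟩ := hz
      have hne : s(v, z.2) ≠ s(v, z.1) := fun h => h12 (Sym2.congr_right.1 h).symm
      rw [bernoulliExp_mem (ψ := fun E => if s(v, z.2) ∈ E then ψ z E else 0), bernoulliExp_mem,
        sq, mul_assoc]
      · exact mem_allEdges.2 (by rw [Sym2.mk_isDiag_iff]; exact h2.symm)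
      · exact fun E => hψins _ _ _
      · exact mem_allEdges.2 (by rw [Sym2.mk_isDiag_iff]; exact h1.symm)
      · intro E
        simp only [hψins, mem_insert, hne, false_or]
    · have hzero : ∀ E, ψ z E = 0 := by
        intro E
        simp only [hψ]
        split_ifs
        · rw [filter_false_of_mem, card_empty, Nat.cast_zero, zero_div]
          rintro g - ⟨h1, h2, h3⟩
          refine hz ⟨h1, h2, fun h => ?_⟩
          rw [h] at h3
          exact not_separates_self g _ h3
        · rfl
      simp only [hzero, ite_self]
      rw [bernoulliExp_const]
      have : ψ z = fun _ => 0 := funext hzero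
      rw [this, bernoulliExp_const, mul_zero]
  calc _ ≤ bernoulliExp p (allEdges V) (fun E => ∑ z : V × V,
          if s(v, z.1) ∈ E then if s(v, z.2) ∈ E then ψ z E else 0 else 0) := by
        refine bernoulliExp_mono hp0.le hp1 fun E hE => ?_
        by_cases hexp : IsExpander p v E
        · rw [if_pos hexp]
          have hne : ∀ z, s(v, z) ∈ E → z ≠ v := by
            rintro z hz rfl
            exact mem_allEdges.1 (hE hz) (by simp)
          simp only [card_filter]
          push_cast
          rw [sum_comm, sum_div]
          refine sum_le_sum fun z _ => ?_
          by_cases h1 : s(v, z.1) ∈ E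
          · by_cases h2 : s(v, z.2) ∈ E
            · simp only [hψ, h1, h2, hexp, hne z.1 h1, hne z.2 h2, if_true, true_and, ne_eq,
                not_false_eq_true, card_filter]
              push_cast
              exact le_rfl
            · simp [h2]
          · simp [h1]
        · rw [if_neg hexp]
          refine sum_nonneg fun z _ => ?_
          split_ifs
          · exact hψ0 z E
          · exact le_rfl
          · exact le_rfl
    _ = ∑ z : V × V, bernoulliExp p (allEdges V) (fun E =>
          if s(v, z.1) ∈ E then if s(v, z.2) ∈ E then ψ z E else 0 else 0) :=
        bernoulliExp_sum _ _
    _ ≤ ∑ z : V × V, p ^ 2 * bernoulliExp p (allEdges V) (ψ z) := sum_le_sum fun z _ => hterm z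
    _ = p ^ 2 * bernoulliExp p (allEdges V) (fun E => ∑ z : V × V, ψ z E) := by
        rw [← mul_sum, bernoulliExp_sum]
    -- Expansion bounds `p / 16` times the separated pairs by the crossing pairs, and `c` times the
    -- latter averages at most `2 * n`.
    _ ≤ p ^ 2 * bernoulliExp p (allEdges V) (fun _ => 32 * n / (p * c)) := by
        refine mul_le_mul_of_nonneg_left ?_ (sq_nonneg p)
        refine bernoulliExp_mono hp0.le hp1 fun E _ => ?_
        by_cases hexp : IsExpander p v E
        · simp only [hψ, if_pos hexp]
          set F := creditForests c {e ∈ E | v ∉ e} with hF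
          have hFpos : (0 : ℝ) < #F := Nat.cast_pos.2 (card_creditForests_pos c _)
          rw [← sum_div, div_le_iff₀ hFpos]
          have h1 : ∑ z : V × V,
              (#{g ∈ F | z.1 ≠ v ∧ z.2 ≠ v ∧ Separates g z.1 z.2} : ℝ) =
              ∑ g ∈ F, (#{z : V × V | z.1 ≠ v ∧ z.2 ≠ v ∧ Separates g z.1 z.2} : ℝ) := by
            simp only [card_filter]
            push_cast
            exact sum_comm
          have h2 : p / 16 * ∑ g ∈ F,
              (#{z : V × V | z.1 ≠ v ∧ z.2 ≠ v ∧ Separates g z.1 z.2} : ℝ) ≤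
              ∑ g ∈ F, (#{z : V × V | s(z.1, z.2) ∈ {e ∈ E | v ∉ e} ∧
                Separates g z.1 z.2} : ℝ) := by
            rw [mul_sum]
            exact sum_le_sum fun g _ => card_separated_le (by positivity) hexp g
          have h3 : (c : ℝ) * ∑ g ∈ F, (#{z : V × V | s(z.1, z.2) ∈ {e ∈ E | v ∉ e} ∧
                Separates g z.1 z.2} : ℝ) ≤ 2 * n * #F := by
            have := sum_card_crossing_le (c := c) {e ∈ E | v ∉ e}
            rw [hV] at this
            exact_mod_cast this
          rw [h1]
          have h4 := mul_le_mul_of_nonneg_left h2 hc0.le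
          rw [div_mul_eq_mul_div, le_div_iff₀ (by positivity)]
          linarith
        · simp only [hψ, if_neg hexp, sum_const_zero]
          positivity
    _ = 32 * n * p / c := by
        rw [bernoulliExp_const]
        field_simp

/-- The probability that `v` has degree at most two in a random forest. -/
noncomputable def lowDegreeProb (c : ℕ) (v : V) (E : Finset (Sym2 V)) : ℝ :=
  (#{f ∈ creditForests c E | edgeDeg f v ≤ 2} : ℝ) / #(creditForests c E)

omit [Fintype V] in
theorem lowDegreeProb_le_one (c : ℕ) (v : V) (E : Finset (Sym2 V)) : lowDegreeProb c v E ≤ 1 :=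
  div_le_one_of_le₀ (Nat.cast_le.2 (card_filter_le _ _)) (Nat.cast_nonneg _)

-- Dividing the count of low-degree forests by the number of all forests factors out the isolation
-- probability and turns the sum over `g` into an average.
open Classical in
theorem lowDegreeProb_le (v : V) (E : Finset (Sym2 V)) :
    lowDegreeProb c v E ≤ isolationProb c v E * (1 + (c * (#{e ∈ E | v ∈ e} : ℝ) +
      c ^ 2 * ((∑ g ∈ creditForests c {e ∈ E | v ∉ e},
        (#{z : V × V | s(v, z.1) ∈ E ∧ s(v, z.2) ∈ E ∧ Separates g z.1 z.2} : ℝ)) /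
          #(creditForests c {e ∈ E | v ∉ e})))) := by
  have h := card_edgeDeg_le_two (c := c) (E := E) v
  have hF : (#(creditForests c {e ∈ E | v ∉ e}) : ℝ) ≠ 0 :=
    Nat.cast_ne_zero.2 (card_creditForests_pos c _).ne'
  rw [lowDegreeProb, isolationProb, div_mul_eq_mul_div]
  refine div_le_div_of_nonneg_right ?_ (Nat.cast_nonneg _)
  rw [mul_add, mul_add, mul_one, mul_left_comm _ ((c : ℝ) ^ 2), mul_div_cancel₀ _ hF]
  have h' := (Nat.cast_le (α := ℝ)).2 h
  push_cast at h'
  linarith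

omit [Fintype V] in
theorem lowDegreeProb_relabel (c : ℕ) (v : V) (E : Finset (Sym2 V)) (σ : Equiv.Perm V) :
    lowDegreeProb c (σ v) (E.image (Sym2.map σ)) = lowDegreeProb c v E := by
  unfold lowDegreeProb
  rw [card_relabel E v σ fun k => k ≤ 2]
  have h := card_relabel (c := c) E v σ fun _ => True
  simp only [filter_true] at h
  rw [h]

/-- The action of a permutation of the nodes on unordered pairs. -/
def relabelPairs (σ : Equiv.Perm V) : Equiv.Perm (Sym2 V) where
  toFun := Sym2.map σ
  invFun := Sym2.map σ.symm
  left_inv e := by rw [Sym2.map_map, Equiv.symm_comp_self, Sym2.map_id]; rfl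
  right_inv e := by rw [Sym2.map_map, Equiv.self_comp_symm, Sym2.map_id]; rfl

theorem image_relabelPairs_allEdges (σ : Equiv.Perm V) :
    (allEdges V).image (relabelPairs σ) = allEdges V := by
  have hdiag : ∀ e, relabelPairs σ e ∈ allEdges V ↔ e ∈ allEdges V := by
    intro e
    induction e using Sym2.ind with
    | _ x y => simp [mem_allEdges, relabelPairs]
  ext e
  rw [mem_image]
  constructor
  · rintro ⟨e, he, rfl⟩
    exact (hdiag e).2 he
  · intro he
    refine ⟨(relabelPairs σ).symm e, ?_, Equiv.apply_symm_apply _ _⟩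
    rwa [← hdiag, Equiv.apply_symm_apply]

/-- By exchangeability every fixed node has low degree with probability at least a third. -/
theorem third_le_bernoulliExp_lowDegreeProb (hp0 : 0 ≤ p) (hp1 : p ≤ 1) (v : V) :
    1 / 3 ≤ bernoulliExp p (allEdges V) (lowDegreeProb c v) := by
  have hexch : ∀ w, bernoulliExp p (allEdges V) (lowDegreeProb c w) =
      bernoulliExp p (allEdges V) (lowDegreeProb c v) := by
    intro w
    -- Swapping the two nodes preserves the law of the random graph and exchanges their low-degree
    -- probabilities.
    set σ : Equiv.Perm V := Equiv.swap w v
    rw [← bernoulliExp_image (relabelPairs σ) (image_relabelPairs_allEdges σ) (lowDegreeProb c v)]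
    refine bernoulliExp_congr fun E _ => ?_
    have h := lowDegreeProb_relabel c w E σ
    rw [Equiv.swap_apply_left] at h
    rw [← h]
    rfl
  have hcard : (0 : ℝ) < Fintype.card V := Nat.cast_pos.2 (Fintype.card_pos_iff.2 ⟨v⟩)
  have hsum : bernoulliExp p (allEdges V) (fun _ => (Fintype.card V : ℝ) / 3) ≤
      bernoulliExp p (allEdges V) (fun E => ∑ w, lowDegreeProb c w E) := by
    refine bernoulliExp_mono hp0 hp1 fun E _ => ?_
    have hpos : (0 : ℝ) < #(creditForests c E) := Nat.cast_pos.2 (card_creditForests_pos c E)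
    have h : ∑ f ∈ creditForests c E, Fintype.card V ≤
        ∑ f ∈ creditForests c E, 3 * #{w | edgeDeg f w ≤ 2} :=
      sum_le_sum fun f hf => card_le_three_mul_card_edgeDeg_le_two hf
    simp only [lowDegreeProb]
    rw [← sum_div, le_div_iff₀ hpos]
    rw [sum_const, smul_eq_mul, ← mul_sum] at h
    have hswap : ∑ f ∈ creditForests c E, #{w | edgeDeg f w ≤ 2} =
        ∑ w, #{f ∈ creditForests c E | edgeDeg f w ≤ 2} := by
      simp only [card_filter]
      exact sum_comm
    rw [hswap] at h
    have h' : (#(creditForests c E) : ℝ) * Fintype.card V ≤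
        3 * ∑ w, (#{f ∈ creditForests c E | edgeDeg f w ≤ 2} : ℝ) := by exact_mod_cast h
    linarith
  rw [bernoulliExp_const, bernoulliExp_sum, sum_congr rfl fun w _ => hexch w, sum_const,
    card_univ, nsmul_eq_mul] at hsum
  nlinarith

theorem bernoulliExp_degree (hp0 : 0 ≤ p) {n : ℕ} (hV : Fintype.card V = n) (v : V) :
    bernoulliExp p (allEdges V) (fun E => (#{e ∈ E | v ∈ e} : ℝ)) ≤ n * p := by
  have h1 : bernoulliExp p (allEdges V) (fun E => (#{e ∈ E | v ∈ e} : ℝ)) =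
      bernoulliExp p (allEdges V) (fun E => ∑ e ∈ cutPairs {v} (univ.erase v),
        if e ∈ E then 1 else 0) := by
    refine bernoulliExp_congr fun E hE => ?_
    rw [← inter_cutPairs_singleton fun e he => mem_allEdges.1 (hE he), inter_comm,
      ← filter_mem_eq_inter, card_filter]
    push_cast
    rfl
  rw [h1, bernoulliExp_sum]
  have h2 : ∀ e ∈ cutPairs {v} (univ.erase v),
      bernoulliExp p (allEdges V) (fun E => if e ∈ E then 1 else 0) = p := by
    intro e he
    rw [bernoulliExp_mem (ψ := fun _ => 1)
      (cutPairs_subset_allEdges (disjoint_singleton_erase v) he) fun _ => rfl,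
      bernoulliExp_const, mul_one]
  rw [sum_congr rfl h2, sum_const, nsmul_eq_mul, card_cutPairs_singleton, hV]
  exact mul_le_mul_of_nonneg_right (Nat.cast_le.2 (Nat.sub_le _ _)) hp0

/-- Linearises a product so that expectations of the factors suffice: where `y ≤ M` the first term
is enough, elsewhere the second exceeds one. -/
theorem le_mul_add_inv_mul {t x y M : ℝ} (ht : t ≤ 1) (hx : 0 ≤ x) (hy : 0 ≤ y) (hM : 0 < M)
    (h : t ≤ x * y) : t ≤ M * x + 1 / M * y := by
  rcases le_total y M with hyM | hyM
  · have h1 := mul_le_mul_of_nonneg_left hyM hx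
    have h2 : 0 ≤ 1 / M * y := by positivity
    linarith
  · have h1 : 1 ≤ 1 / M * y := by
      rwa [one_div, inv_mul_eq_div, le_div_iff₀ hM, one_mul]
    have h2 : 0 ≤ M * x := by positivity
    linarith

/-- The lower bound for the isolation probability in the random graph. -/
theorem le_bernoulliExp_isolationProb {n : ℕ} (hV : Fintype.card V = n) (hn : 17 ≤ n)
    (hc : 1 ≤ c) (hp0 : 0 < p) (hp1 : p ≤ 1) (hp : 8 * Real.log n ≤ n * p)
    (hnpc : 1 ≤ n * p * c) (v : V) :
    1 / 4896 / (n * p * c) ≤ bernoulliExp p (allEdges V) (isolationProb c v) := by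
  classical
  have hc1 : (1 : ℝ) ≤ c := by exact_mod_cast hc
  set m : ℝ := n * p * c with hm
  obtain ⟨W, hWexp, hW0, hWle⟩ : ∃ W : Finset (Sym2 V) → ℝ,
      bernoulliExp p (allEdges V) W ≤ 32 * n * p / c ∧ (∀ E, 0 ≤ W E) ∧
        ∀ E, IsExpander p v E → lowDegreeProb c v E ≤
          isolationProb c v E * (1 + (c * (#{e ∈ E | v ∈ e} : ℝ) + c ^ 2 * W E)) := by
    refine ⟨_, bernoulliExp_separated_le hV hc hp0 hp1 v, fun E => ?_, fun E hE => ?_⟩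
    · split_ifs
      · exact div_nonneg (sum_nonneg fun _ _ => Nat.cast_nonneg _) (Nat.cast_nonneg _)
      · exact le_rfl
    · rw [if_pos hE]
      exact lowDegreeProb_le v E
  -- The second factor has expectation at most `1 + m + 32 * m ≤ 34 * m`, so `M = 408 * m` makes its
  -- share at most `1 / 12`. Non-expanders cost `1 / 6`, which leaves `1 / 12` of the `1 / 3`; and
  -- `12 * 408 = 4896`.
  have hpt : ∀ E ⊆ allEdges V, lowDegreeProb c v E ≤
      (408 * m * isolationProb c v E + 1 / (408 * m) *
        (1 + (c * (#{e ∈ E | v ∈ e} : ℝ) + c ^ 2 * W E))) +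
          if IsExpander p v E then 0 else 1 := by
    intro E _
    have hY0 : 0 ≤ 1 + (c * (#{e ∈ E | v ∈ e} : ℝ) + c ^ 2 * W E) :=
      add_nonneg zero_le_one (add_nonneg (mul_nonneg (Nat.cast_nonneg _) (Nat.cast_nonneg _))
        (mul_nonneg (sq_nonneg _) (hW0 E)))
    have hX0 := isolationProb_nonneg c v E
    have hM : 0 < 408 * m := by linarith
    split_ifs with hexp
    · rw [add_zero]
      exact le_mul_add_inv_mul (lowDegreeProb_le_one c v E) hX0 hY0 hM (hWle E hexp)
    · refine (lowDegreeProb_le_one c v E).trans (le_add_of_nonneg_left ?_)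
      exact add_nonneg (mul_nonneg hM.le hX0) (mul_nonneg (one_div_nonneg.2 hM.le) hY0)
  have h1 := (third_le_bernoulliExp_lowDegreeProb (c := c) hp0.le hp1 v).trans
    (bernoulliExp_mono hp0.le hp1 hpt)
  rw [bernoulliExp_add, bernoulliExp_add, bernoulliExp_mul_left, bernoulliExp_mul_left,
    bernoulliExp_add, bernoulliExp_add, bernoulliExp_mul_left, bernoulliExp_mul_left,
    bernoulliExp_const] at h1
  have h2 := bernoulliExp_not_isExpander_le hV hn hp0 hp1 hp v
  have h3 := mul_le_mul_of_nonneg_left (bernoulliExp_degree hp0.le hV v) (zero_le_one.trans hc1)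
  have h4 := mul_le_mul_of_nonneg_left hWexp (sq_nonneg (c : ℝ))
  have h5 : (c : ℝ) ^ 2 * (32 * n * p / c) = 32 * m := by
    rw [hm]
    field_simp
  have h6 : (c : ℝ) * (n * p) = m := by rw [hm]; ring
  have h7 : 1 / (408 * m) * (1 + (c * bernoulliExp p (allEdges V)
      (fun E => (#{e ∈ E | v ∈ e} : ℝ)) + c ^ 2 * bernoulliExp p (allEdges V) W)) ≤ 1 / 12 := by
    rw [one_div, inv_mul_eq_div, div_le_iff₀ (by linarith)]
    linarith
  rw [div_le_iff₀ (by linarith)]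
  linarith

end RandomForest

end

/-! ### The theorem, with constants `1 / 4896` and `36`. -/

theorem mainTheorem8 :
    ∃ k K : ℝ, 0 < k ∧ 0 < K ∧
      ∀ (n c : ℕ), 1 ≤ c → ∀ p : unitInterval,
        8 * Real.log ((c : ℝ) * (n : ℝ)) / (n : ℝ) < (p : ℝ) →
      ∀ (Λ : SimpleGraph (Fin n) → Matrix (Fin n) (Fin n) ℝ)
        (R : ∀ G : SimpleGraph (Fin n), RoutingRule G c),
        (∀ᵐ G ∂(SimpleGraph.binomialRandom (Fin n) p),
          IsTransactionRate (Λ G) ∧ (Λ G).IsSymm ∧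
            IsErgodicChain (transitionMatrix (R G) (Λ G))) →
        (∀ᵐ G ∂(SimpleGraph.binomialRandom (Fin n) p),
          ∃! π : CreditState G c → ℝ,
            IsStationaryDistribution (transitionMatrix (R G) (Λ G)) π) ∧
        ∀ π : ∀ G : SimpleGraph (Fin n), CreditState G c → ℝ,
          (∀ᵐ G ∂(SimpleGraph.binomialRandom (Fin n) p),
            IsStationaryDistribution (transitionMatrix (R G) (Λ G)) (π G)) →
          ∀ v : Fin n,
            k / ((n : ℝ) * (p : ℝ) * (c : ℝ)) ≤
                ∫ G, bankruptcyProb (π G) v ∂(SimpleGraph.binomialRandom (Fin n) p) ∧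
              ∫ G, bankruptcyProb (π G) v ∂(SimpleGraph.binomialRandom (Fin n) p) ≤
                K / ((n : ℝ) * (p : ℝ) * (c : ℝ)) := by
  classical
  refine ⟨1 / 4896, 36, by norm_num, by norm_num, fun n c hc p hp Λ R h => ⟨?_, fun π hπ v => ?_⟩⟩
  · filter_upwards [h] with G ⟨hΛ, _, hirr, _⟩
    have := nonempty_creditState G c
    exact existsUnique_stationary hirr (CreditState.transitionMatrix_mulVec_one (R G) hΛ)
  -- On a single node the zero diagonal contradicts total rate one, so a transaction rate matrix
  -- forces at least two nodes.
  · have hn : 2 ≤ n := by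
      obtain ⟨G, hΛ, -⟩ := h.exists
      by_contra hlt
      have hsub : Subsingleton (Fin n) := Fin.subsingleton_iff_le_one.2 (by omega)
      have h1 := hΛ.sum_eq_one
      have h0 : ∀ s t, Λ G s t = 0 := fun s t => by rw [Subsingleton.elim t s, hΛ.diag s]
      simp [h0] at h1
    obtain ⟨h17, hnpc, hp0, hlogn, hlogc⟩ := large_of_log_lt hn hc p.2.2 hp
    have hint : ∫ G, bankruptcyProb (π G) v ∂(SimpleGraph.binomialRandom (Fin n) p) =
        bernoulliExp (p : ℝ) (allEdges (Fin n)) (isolationProb c v) := by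
      rw [← integral_binomialRandom]
      refine MeasureTheory.integral_congr_ae ?_
      filter_upwards [h, hπ] with G ⟨hΛ, hsymm, hirr, _⟩ hG
      exact bankruptcyProb_eq_forests (fun _ => mem_edgesOf) (R G) hΛ hsymm hirr hG v
    rw [hint]
    exact ⟨le_bernoulliExp_isolationProb (Fintype.card_fin n) h17 hc hp0 p.2.2 hlogn hnpc v,
      bernoulliExp_isolationProb_le (Fintype.card_fin n) h17 hc hp0 p.2.2 hlogc v⟩
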